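/- Let $M$ be a simply-connected (in particular connected) oriented smooth surface and $f\colon M\to\mathbb{R}^4$ a smooth immersion; $M$ carries the induced metric and the normal bundle $N_fM$ the orientation induced by those of $M$ and $\mathbb{R}^4$. *Conventions.* Let $\delta=\frac{d}{dt}|_{t=0}$. For an immersion $g$ of $M$ and positively oriented orthonormal frame fields $\{e_1,e_2\}$ of $TM$ (with the metric induced by $g$) and $\{e_3,e_4\}$ of $N_gM$, put $\varepsilon_j=g_*e_j$ ($j=1,2$), $\varepsilon_a=e_a$ ($a=3,4$). The dual forms are $\omega_j=\langle \varepsilon_j,dg\rangle$, $j=1,2$, and the connection forms are $\omega_{kl}=\langle d\varepsilon_k,\varepsilon_l\rangle$, $1\le k,l\le 4$. A smooth section $\mathcal T\colon M\to\mathbb{R}^4$ of $f^*(T\mathbb{R}^4)$ is a *bending field* of $f$ if $\langle d\mathcal T(X),df(Y)\rangle+\langle df(X),d\mathcal T(Y)\rangle=0$ for all tangent vectors $X,Y$ at the same point; it is *trivial* if $\mathcal T=\delta(R_t\circ f)$ for a smooth one-parameter family $R_t$ of isometries of $\mathbb{R}^4$ with $R_0=\mathrm{id}$. Let $D\subset\mathbb{R}\times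 M$ be an open neighbourhood of $\{0\}\times M$ (for instance $I\times M$ with an open interval $I\ni 0$). An *infinitesimal isometric deformation* of $f$ over $D$ is a smooth map $F$ on $D$, $f_t=F(t,\cdot)$, with $f_0=f$ and $\delta(f_t^*\langle\cdot,\cdot\rangle)=0$; every bending field $\mathcal T$ determines the one given by $f_t=f+t\mathcal T$. An *adapted frame field* of $F$ over $D$ is a family $\{e_k(t)\}_{1\le k\le4}$, smooth on $D$, such that for every $t$ the pairs $\{e_1(t),e_2(t)\}$ and $\{e_3(t),e_4(t)\}$ are positively oriented orthonormal frame fields of the tangent bundle with the metric induced by $f_t$ and of the normal bundle of $f_t$, respectively, and $\delta e_1(t)=\delta e_2(t)=0$. The same notion is used over open subsets $I\times U\subset\mathbb{R}\times M$, $0\in I$. The *fundamental system* relative to a frame field $\{e_k\}$ of $f$ is the following system for smooth 1-forms $\varphi_{kl}$, $1\le k,l\le4$, on $M$: $$\varphi_{12}=0,\qquad \varphi_{kl}=-\varphi_{lk}\quad(1\le k,l\le 4),$$ $$\sum_{j=1}^2\omega_j\wedge\varphi_{ja}=0\quad(a=3,4),$$ $$d\varphi_{ja}=\sum_{r=1}^{2}\omega_{jr}\wedge\varphi_{ra}+\sum_{b=3}^{4}(\varphi_{jb}\wedge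 \omega_{ba}+\omega_{jb}\wedge\varphi_{ba})\quad(j=1,2,\ a=3,4),$$ $$\sum_{a=3}^4(\varphi_{1a}\wedge\omega_{a2}+\omega_{1a}\wedge\varphi_{a2})=0,\qquad d\varphi_{34}=\sum_{j=1}^2(\varphi_{3j}\wedge\omega_{j4}+\omega_{3j}\wedge\varphi_{j4}).$$ **Theorem.** (i) Let $F$ be an infinitesimal isometric deformation of $f$ over $D$ and $\{e_k(t)\}$ an adapted frame field of $F$ over $D$, with dual forms $\omega_j(t)$ and connection forms $\omega_{kl}(t)$. Then $\delta\omega_1(t)=\delta\omega_2(t)=0$, and the variations $\varphi_{kl}=\delta\omega_{kl}(t)$ exist, are smooth, and satisfy the fundamental system relative to $\{e_k(0)\}$. (ii) Let $\{e_1,e_2\}$ and $\{e_3,e_4\}$ be positively oriented smooth orthonormal frame fields of $TM$ and $N_fM$ on $M$, and let $\{\varphi_{kl}\}$ be a solution of the fundamental system relative to $\{e_k\}$. Say that a bending field $\mathcal T$ *realizes* $\{\varphi_{kl}\}$ if, over some open neighbourhood $D$ of $\{0\}\times M$, $\{e_k\}$ extends to an adapted frame field of $f_t=f+t\mathcal T$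 with $\delta\omega_1(t)=\delta\omega_2(t)=0$ and $\delta\omega_{kl}(t)=\varphi_{kl}$ for all $k,l$. Then there is a bending field $\mathcal T$ which realizes $\{\varphi_{kl}\}$, and a bending field $\mathcal T'$ realizes $\{\varphi_{kl}\}$ if and only if $\mathcal T'-\mathcal T$ is trivial. In particular, every point of $M$ has an open neighbourhood $U$ such that, for some open interval $I\ni0$, $\{e_k\}$ extends over $I\times U$ to an adapted frame field of $f+t\mathcal T$ with $\delta\omega_1(t)=\delta\omega_2(t)=0$ and variations $\delta\omega_{kl}(t)=\varphi_{kl}$. -/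

import Mathlib

open scoped Manifold ContDiff
open Set

noncomputable section

namespace InfBending

/-- The model space of surfaces. -/
abbrev Plane := EuclideanSpace ℝ (Fin 2)

/-- The ambient Euclidean space. -/
abbrev Space4 := EuclideanSpace ℝ (Fin 4)

/-- Tangent indices `1, 2` among `1, …, 4` (counted from `0`). -/
abbrev tIdx (j : Fin 2) : Fin 4 := Fin.castAdd 2 j

/-- Normal indices `3, 4` among `1, …, 4` (counted from `0`). -/
abbrev nIdx (a : Fin 2) : Fin 4 := Fin.natAdd 2 a

/-- `v` is a basis of `V` belonging to the orientation `o`. -/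
def IsPositiveBasis {ι V : Type*} [Fintype ι] [DecidableEq ι] [AddCommGroup V] [Module ℝ V]
    (o : Orientation ℝ V ι) (v : ι → V) : Prop :=
  ∃ b : Module.Basis ι ℝ V, (∀ i, b i = v i) ∧ b.orientation = o

/-- The standard orientation of `ℝ⁴`. -/
def stdOrientation : Orientation ℝ Space4 (Fin 4) :=
  (EuclideanSpace.basisFun (Fin 4) ℝ).toBasis.orientation

section Surface

variable {M : Type*} [TopologicalSpace M] [ChartedSpace Plane M]

/-- A pair `(X₁, X₂)` of (not necessarily continuous) tangent vector fields. -/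
abbrev TangentPair (M : Type*) [TopologicalSpace M] [ChartedSpace Plane M] :=
  Fin 2 → ∀ p : M, TangentSpace 𝓘(ℝ, Plane) p

/-- A pair of `ℝ⁴`-valued fields along the surface. -/
abbrev NormalPair (M : Type*) := Fin 2 → M → Space4

/-- (Not necessarily continuous) real 1-forms. -/
abbrev OneForm (M : Type*) [TopologicalSpace M] [ChartedSpace Plane M] :=
  ∀ p : M, TangentSpace 𝓘(ℝ, Plane) p →L[ℝ] ℝ

/-- 2-forms, as real functions of two tangent vectors at the same point. -/
abbrev TwoForm (M : Type*) [TopologicalSpace M] [ChartedSpace Plane M] :=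
  ∀ p : M, TangentSpace 𝓘(ℝ, Plane) p → TangentSpace 𝓘(ℝ, Plane) p → ℝ

/-- An orientation of the surface: orientations of the tangent planes such that around every
point there is a smooth positively oriented frame field. -/
def IsSurfaceOrientation [IsManifold 𝓘(ℝ, Plane) ∞ M]
    (o : ∀ p : M, Orientation ℝ (TangentSpace 𝓘(ℝ, Plane) p) (Fin 2)) : Prop :=
  ∀ p : M, ∃ U : Set M, IsOpen U ∧ p ∈ U ∧ ∃ X : TangentPair M,
    (∀ j, ContMDiffOn 𝓘(ℝ, Plane) 𝓘(ℝ, Plane).tangent ∞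
      (fun q => (⟨q, X j q⟩ : TangentBundle 𝓘(ℝ, Plane) M)) U) ∧
    ∀ q ∈ U, IsPositiveBasis (o q) (fun j => X j q)

/-! ### Differential forms -/

/-- `(α ∧ β)(u, v) = α(u) β(v) - α(v) β(u)`. -/
def wedge (α β : OneForm M) : TwoForm M :=
  fun p u v => α p u * β p v - α p v * β p u

/-- The expression of a 1-form in the chart around `p`: its pull-back by the inverse chart. -/
def OneForm.inChart (α : OneForm M) (p : M) : Plane → (Plane →L[ℝ] ℝ) :=
  fun y => (α ((chartAt Plane p).symm y)).comp
    (mfderiv 𝓘(ℝ, Plane) 𝓘(ℝ, Plane) (chartAt Plane p).symm y)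

/-- Smooth 1-forms: those with smooth coefficients in the charts. -/
def OneForm.IsSmooth (α : OneForm M) : Prop :=
  ∀ p : M, ContDiffOn ℝ ∞ (α.inChart p) (chartAt Plane p).target

/-- The exterior derivative, with `dα(X, Y) = X(α(Y)) - Y(α(X)) - α([X, Y])`, computed at `p` in
the chart around `p`. -/
def OneForm.d (α : OneForm M) : TwoForm M :=
  fun p u v =>
    let c := chartAt Plane p
    let A : TangentSpace 𝓘(ℝ, Plane) p →L[ℝ] Plane := mfderiv 𝓘(ℝ, Plane) 𝓘(ℝ, Plane) c p
    fderiv ℝ (α.inChart p) (c p) (A u) (A v) - fderiv ℝ (α.inChart p) (c p) (A v) (A u)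

/-! ### Frames and connection forms -/

/-- The differential of an `ℝ⁴`-valued map; it is also the derivative `∇̃` of a section of the
flat bundle `f^*(Tℝ⁴)`. -/
def diff (g : M → Space4) (p : M) : TangentSpace 𝓘(ℝ, Plane) p →L[ℝ] Space4 :=
  mfderiv 𝓘(ℝ, Plane) 𝓘(ℝ, Space4) g p

/-- The fields `ε₁ = g_* e₁`, `ε₂ = g_* e₂`, `ε₃ = e₃`, `ε₄ = e₄` along `g`. -/
def eps (g : M → Space4) (e : TangentPair M) (ν : NormalPair M) : Fin 4 → M → Space4 :=
  Fin.append (fun (j : Fin 2) p => diff g p (e j p)) ν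

/-- At `p`, `(e₁, e₂)` is a positively oriented orthonormal basis of the tangent plane with the
metric induced by `g`, and `(ν₁, ν₂)` is a positively oriented orthonormal basis of the normal
plane of `g`, whose orientation is induced by those of the surface and of `ℝ⁴`. -/
def IsOrthonormalFrameAt (o : ∀ p : M, Orientation ℝ (TangentSpace 𝓘(ℝ, Plane) p) (Fin 2))
    (g : M → Space4) (e : TangentPair M) (ν : NormalPair M) (p : M) : Prop :=
  Orthonormal ℝ (fun k => eps g e ν k p) ∧
  IsPositiveBasis (o p) (fun j => e j p) ∧
  IsPositiveBasis stdOrientation (fun k => eps g e ν k p)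

/-- The dual 1-forms `ω_j(X) = ⟨g_* e_j, g_* X⟩` of `(e₁, e₂)` in the metric induced by `g`. -/
def coframe (g : M → Space4) (e : TangentPair M) (j : Fin 2) : OneForm M :=
  fun p => (innerSL ℝ (diff g p (e j p))).comp (diff g p)

/-- The connection forms `ω_{kl}(X) = ⟨∇̃_X ε_k, ε_l⟩`. -/
def connForm (g : M → Space4) (e : TangentPair M) (ν : NormalPair M) (k l : Fin 4) :
    OneForm M :=
  fun p => (innerSL ℝ (eps g e ν l p)).comp (diff (eps g e ν k) p)

/-- `φ = {φ_{kl}}` is a solution of the fundamental system relative to the frame `(e, ν)` of `f`.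
It consists of smooth 1-forms. -/
structure IsFundamentalSolution (f : M → Space4) (e : TangentPair M) (ν : NormalPair M)
    (φ : Fin 4 → Fin 4 → OneForm M) : Prop where
  smooth : ∀ k l, (φ k l).IsSmooth
  /-- `φ₁₂ = 0` -/
  tangential : φ (tIdx 0) (tIdx 1) = 0
  /-- `φ_{kl} = -φ_{lk}` -/
  skew : ∀ k l, φ k l = -φ l k
  /-- `∑_j ω_j ∧ φ_{ja} = 0` -/
  symm : ∀ a : Fin 2, ∑ j : Fin 2, wedge (coframe f e j) (φ (tIdx j) (nIdx a)) = 0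
  /-- `dφ_{ja} = ∑_r ω_{jr} ∧ φ_{ra} + ∑_b (φ_{jb} ∧ ω_{ba} + ω_{jb} ∧ φ_{ba})` -/
  codazzi : ∀ j a : Fin 2, (φ (tIdx j) (nIdx a)).d =
    ∑ r : Fin 2, wedge (connForm f e ν (tIdx j) (tIdx r)) (φ (tIdx r) (nIdx a)) +
    ∑ b : Fin 2, (wedge (φ (tIdx j) (nIdx b)) (connForm f e ν (nIdx b) (nIdx a)) +
      wedge (connForm f e ν (tIdx j) (nIdx b)) (φ (nIdx b) (nIdx a)))
  /-- `∑_a (φ_{1a} ∧ ω_{a2} + ω_{1a} ∧ φ_{a2}) = 0` -/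
  gauss : ∑ a : Fin 2, (wedge (φ (tIdx 0) (nIdx a)) (connForm f e ν (nIdx a) (tIdx 1)) +
      wedge (connForm f e ν (tIdx 0) (nIdx a)) (φ (nIdx a) (tIdx 1))) = 0
  /-- `dφ₃₄ = ∑_j (φ_{3j} ∧ ω_{j4} + ω_{3j} ∧ φ_{j4})` -/
  ricci : (φ (nIdx 0) (nIdx 1)).d =
    ∑ j : Fin 2, (wedge (φ (nIdx 0) (tIdx j)) (connForm f e ν (tIdx j) (nIdx 1)) +
      wedge (connForm f e ν (nIdx 0) (tIdx j)) (φ (tIdx j) (nIdx 1)))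

/-! ### Deformations and bending fields -/

/-- `T` is a bending field of `f`. -/
def IsBendingField (f T : M → Space4) : Prop :=
  ContMDiff 𝓘(ℝ, Plane) 𝓘(ℝ, Space4) ∞ T ∧
  ∀ (p : M) (X Y : TangentSpace 𝓘(ℝ, Plane) p),
    inner ℝ (diff T p X) (diff f p Y) + inner ℝ (diff f p X) (diff T p Y) = 0

/-- `T` is the variational field of a deformation of `f` by a smooth one-parameter family of
isometries of `ℝ⁴`. -/
def IsTrivialField (f T : M → Space4) : Prop :=
  ∃ R : ℝ → (Space4 ≃ᵢ Space4),
    ContDiff ℝ ∞ (fun q : ℝ × Space4 => R q.1 q.2) ∧ R 0 = IsometryEquiv.refl Space4 ∧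
    ∀ p, HasDerivAt (fun t => R t (f p)) (T p) 0

/-- `F`, defined on the subset `D` of `ℝ × M`, is an infinitesimal isometric deformation of `f`:
it is smooth, `F(0, ·) = f`, and the derivative at `t = 0` of the metric induced by `F(t, ·)`
vanishes. -/
def IsInfIsometricDeformation (D : Set (ℝ × M)) (f : M → Space4) (F : ℝ → M → Space4) : Prop :=
  ContMDiffOn (𝓘(ℝ, ℝ).prod 𝓘(ℝ, Plane)) 𝓘(ℝ, Space4) ∞ (fun q : ℝ × M => F q.1 q.2) D ∧
  F 0 = f ∧
  ∀ p, (0, p) ∈ D → ∀ X Y : TangentSpace 𝓘(ℝ, Plane) p,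
    HasDerivAt (fun t => inner ℝ (diff (F t) p X) (diff (F t) p Y)) 0 0

/-- The deformation `f_t = f + tT`. -/
def linearDeformation (f T : M → Space4) : ℝ → M → Space4 := fun t p => f p + t • T p

/-- `(e, ν)` is an adapted orthonormal frame field, over the subset `D` of `ℝ × M`, of the
deformation `F`: it is smooth, it is for every `t` a positively oriented orthonormal frame of
`F(t, ·)`, and the derivatives of `e₁(t)` and `e₂(t)` at `t = 0` vanish. -/
def IsAdaptedFrame [IsManifold 𝓘(ℝ, Plane) ∞ M]
    (o : ∀ p : M, Orientation ℝ (TangentSpace 𝓘(ℝ, Plane) p) (Fin 2))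
    (D : Set (ℝ × M)) (F : ℝ → M → Space4) (e : ℝ → TangentPair M) (ν : ℝ → NormalPair M) :
    Prop :=
  (∀ j, ContMDiffOn (𝓘(ℝ, ℝ).prod 𝓘(ℝ, Plane)) 𝓘(ℝ, Plane).tangent ∞
    (fun q : ℝ × M => (⟨q.2, e q.1 j q.2⟩ : TangentBundle 𝓘(ℝ, Plane) M)) D) ∧
  (∀ a, ContMDiffOn (𝓘(ℝ, ℝ).prod 𝓘(ℝ, Plane)) 𝓘(ℝ, Space4) ∞
    (fun q : ℝ × M => ν q.1 a q.2) D) ∧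
  (∀ t p, (t, p) ∈ D → IsOrthonormalFrameAt o (F t) (e t) (ν t) p) ∧
  ∀ p, (0, p) ∈ D → ∀ j, HasDerivAt (fun t => e t j p) 0 0

/-- The family `β(t)` of 1-forms has at `p` the variation (derivative at `t = 0`) `α`. -/
def HasVariationAt (β : ℝ → OneForm M) (α : OneForm M) (p : M) : Prop :=
  ∀ X : TangentSpace 𝓘(ℝ, Plane) p, HasDerivAt (fun t => β t p X) (α p X) 0

/-- Over `D`, the frame `(e, ν)` of `f` extends to an adapted frame of the deformation
`f_t = f + tT` for which the variations of `ω_j(t)` vanish and those of `ω_{kl}(t)` are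
`φ_{kl}`. -/
def ExtendsOver [IsManifold 𝓘(ℝ, Plane) ∞ M]
    (o : ∀ p : M, Orientation ℝ (TangentSpace 𝓘(ℝ, Plane) p) (Fin 2))
    (D : Set (ℝ × M)) (f T : M → Space4) (e : TangentPair M) (ν : NormalPair M)
    (φ : Fin 4 → Fin 4 → OneForm M) : Prop :=
  ∃ (e' : ℝ → TangentPair M) (ν' : ℝ → NormalPair M),
    IsAdaptedFrame o D (linearDeformation f T) e' ν' ∧
    ∀ p, (0, p) ∈ D →
      (∀ j, e' 0 j p = e j p) ∧ (∀ a, ν' 0 a p = ν a p) ∧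
      (∀ j, HasVariationAt (fun t => coframe (linearDeformation f T t) (e' t) j) 0 p) ∧
      ∀ k l, HasVariationAt (fun t => connForm (linearDeformation f T t) (e' t) (ν' t) k l)
        (φ k l) p

/-- `T` realizes `φ`: the extension exists over an open neighbourhood of `{0} × M`. -/
def Realizes [IsManifold 𝓘(ℝ, Plane) ∞ M]
    (o : ∀ p : M, Orientation ℝ (TangentSpace 𝓘(ℝ, Plane) p) (Fin 2))
    (f T : M → Space4) (e : TangentPair M) (ν : NormalPair M)
    (φ : Fin 4 → Fin 4 → OneForm M) : Prop :=
  ∃ D : Set (ℝ × M), IsOpen D ∧ (∀ p, (0, p) ∈ D) ∧ ExtendsOver o D f T e ν φ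

end Surface

end InfBending

end

/-! The moving frame `ε₁,…,ε₄` of an adapted deformation stays orthonormal, so its velocity at `t =
0` is `δε_k = A ε_k` for a smooth field `A` of skew endomorphisms of ℝ⁴. Since `δe₁ = δe₂ = 0`, the
variational field `T` satisfies `dT = A ∘ df`, and differentiating `⟨dε_k, ε_l⟩` gives `δω_{kl} =
⟨dA ε_k, ε_l⟩`. The theorem is thus a statement about the single so(4)-valued form `dA`, read in the
frame (`exists_rotation`).

In these terms the fundamental system says that a skew-endomorphism-valued 1-form `B` with
components `φ_{kl}` is closed (Codazzi, Gauss, Ricci) and satisfies `B ∧ df = 0` (symmetry). For `B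
= dA` the second condition is `d(dT) = 0`. The equation `φ₁₂ = 0` is then automatic, because a
trilinear form symmetric in one pair of arguments and skew in an overlapping pair vanishes
(`isSkew_symm_eq_zero`). This gives (i), via `isFundamentalSolution_frameForm`.

Conversely, a solution `φ` assembles into a closed form `B` (`frameCombination_spec`). On a simply
connected surface `B = dA`, then `A ∘ df` is closed because `dA ∧ df = 0`, and a second integration
yields `T` (`exists_rotation_of_isFundamentalSolution`). The frame extends along `f + tT` by the
Gram-Schmidt process applied to `ε_k + t A ε_k`, which leaves first-order behaviour unchanged
(`exists_adaptedFrame`). Two realizing fields have rotation fields differing by a constant skew `C`,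
so they differ by `C f + v`; such fields are exactly the trivial ones. -/

noncomputable section

set_option maxSynthPendingDepth 3

namespace InfBending

/-! ### Vector-valued 1-forms and their exterior derivative. -/

section FormCalculus

variable {M : Type*} [TopologicalSpace M] [ChartedSpace Plane M]
variable {V W : Type*} [NormedAddCommGroup V] [NormedSpace ℝ V]
  [NormedAddCommGroup W] [NormedSpace ℝ W]

/-- `V`-valued 1-forms, with the tangent planes identified with the model plane. -/
abbrev VForm (M V : Type*) [NormedAddCommGroup V] [NormedSpace ℝ V] := M → Plane →L[ℝ] V

/-- The differential of a `V`-valued map. -/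
def vdiff (g : M → V) : VForm M V := fun p => mfderiv 𝓘(ℝ, Plane) 𝓘(ℝ, V) g p

/-- The differential of the inverse of the chart around `p`. -/
def chartSymmDeriv (p : M) (y : Plane) : Plane →L[ℝ] Plane :=
  mfderiv 𝓘(ℝ, Plane) 𝓘(ℝ, Plane) (chartAt Plane p).symm y

/-- The expression of a `V`-valued 1-form in the chart around `p`. -/
def VForm.inChart (α : VForm M V) (p : M) : VForm Plane V :=
  fun y => (α ((chartAt Plane p).symm y)).comp (chartSymmDeriv p y)

/-- Smooth `V`-valued 1-forms. -/
def VForm.IsSmooth (α : VForm M V) : Prop :=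
  ∀ p : M, ContDiffOn ℝ ∞ (α.inChart p) (chartAt Plane p).target

/-- The exterior derivative of a `V`-valued 1-form. -/
def VForm.d (α : VForm M V) (p : M) (u v : Plane) : V :=
  fderiv ℝ (α.inChart p) (chartAt Plane p p) u v - fderiv ℝ (α.inChart p) (chartAt Plane p p) v u

theorem minSmoothness_two_le_infty : minSmoothness ℝ 2 ≤ ∞ := by
  simp only [minSmoothness_of_isRCLikeNormedField]
  exact (WithTop.coe_le_coe.2 le_top : ((2 : ℕ∞) : WithTop ℕ∞) ≤ ∞)

theorem chart_target_mem_nhds (p : M) : (chartAt Plane p).target ∈ nhds (chartAt Plane p p) :=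
  (chartAt Plane p).open_target.mem_nhds (mem_chart_target Plane p)

theorem hasMFDerivAt_comp_chart_symm (p : M) {y : Plane} (hy : y ∈ (chartAt Plane p).target)
    [IsManifold 𝓘(ℝ, Plane) ∞ M] {g : M → V} {L : Plane →L[ℝ] V}
    (hg : HasMFDerivAt 𝓘(ℝ, Plane) 𝓘(ℝ, V) g ((chartAt Plane p).symm y) L) :
    HasFDerivAt (g ∘ (chartAt Plane p).symm) (L.comp (chartSymmDeriv p y)) y := by
  have : IsManifold 𝓘(ℝ, Plane) 1 M := IsManifold.of_le (n := ∞) (by simp)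
  have h1 := (mdifferentiableAt_atlas_symm (I := 𝓘(ℝ, Plane)) (chart_mem_atlas Plane p)
    hy).hasMFDerivAt
  exact (hg.comp y h1).hasFDerivAt

theorem hasMFDerivAt_of_comp_chart_symm (p : M) {y : Plane} (hy : y ∈ (chartAt Plane p).target)
    [IsManifold 𝓘(ℝ, Plane) ∞ M] {g : M → V} {L : Plane →L[ℝ] V}
    (hg : HasFDerivAt (g ∘ (chartAt Plane p).symm) (L.comp (chartSymmDeriv p y)) y) :
    HasMFDerivAt 𝓘(ℝ, Plane) 𝓘(ℝ, V) g ((chartAt Plane p).symm y) L := by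
  have : IsManifold 𝓘(ℝ, Plane) 1 M := IsManifold.of_le (n := ∞) (by simp)
  set c := chartAt Plane p
  set q := c.symm y
  have hq : q ∈ c.source := c.map_target hy
  have h1 := (mdifferentiableAt_atlas (I := 𝓘(ℝ, Plane)) (chart_mem_atlas Plane p)
    hq).hasMFDerivAt
  have hcq : c q = y := c.right_inv hy
  have h2 : HasMFDerivAt 𝓘(ℝ, Plane) 𝓘(ℝ, V) (g ∘ c.symm) (c q) (L.comp (chartSymmDeriv p y)) := by
    rw [hcq]; exact hg.hasMFDerivAt
  have h3 := h2.comp q h1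
  have h4 : HasMFDerivAt 𝓘(ℝ, Plane) 𝓘(ℝ, V) g q
      ((L.comp (chartSymmDeriv p y)).comp (mfderiv 𝓘(ℝ, Plane) 𝓘(ℝ, Plane) c q)) := by
    refine h3.congr_of_eventuallyEq ?_
    filter_upwards [c.open_source.mem_nhds hq] with x hx
    simp [c.left_inv hx]
  have h5 := (mdifferentiable_chart (I := 𝓘(ℝ, Plane)) p).symm_comp_deriv (x := q) hq
  have h6 : (L.comp (chartSymmDeriv p y)).comp
      (mfderiv 𝓘(ℝ, Plane) 𝓘(ℝ, Plane) c q : Plane →L[ℝ] Plane) = L := by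
    ext X
    have h7 : chartSymmDeriv p y = mfderiv 𝓘(ℝ, Plane) 𝓘(ℝ, Plane) c.symm (c q) := by
      rw [hcq]; rfl
    rw [h7]
    exact congrArg (fun A : Plane →L[ℝ] Plane => L (A X)) h5
  exact h6 ▸ h4

variable [IsManifold 𝓘(ℝ, Plane) ∞ M]

/-- The tangent space at `p` is the model plane as seen in the preferred chart at `p`, so that chart
has identity derivative there. Hence values at `p` can be read in this chart without any transport.
-/
theorem chartSymmDeriv_self (p : M) :
    chartSymmDeriv p (chartAt Plane p p) = ContinuousLinearMap.id ℝ Plane := by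
  have : IsManifold 𝓘(ℝ, Plane) 1 M := IsManifold.of_le (n := ∞) (by simp)
  have h := (mdifferentiableAt_atlas_symm (I := 𝓘(ℝ, Plane)) (chart_mem_atlas Plane p)
    (mem_chart_target Plane p))
  have h' : (chartAt Plane p).symm (chartAt Plane p p) = p :=
    (chartAt Plane p).left_inv (mem_chart_source Plane p)
  unfold chartSymmDeriv
  rw [h.mfderiv]
  simp only [writtenInExtChartAt, modelWithCornersSelf_coe, range_id, fderivWithin_univ,
    extChartAt_model_space_eq_id, PartialEquiv.refl_coe, PartialEquiv.refl_symm]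
  have : HasFDerivAt (fun x : Plane => x) (ContinuousLinearMap.id ℝ Plane) (chartAt Plane p p) :=
    hasFDerivAt_id _
  refine (this.congr_of_eventuallyEq ?_).fderiv
  filter_upwards [chart_target_mem_nhds p] with y hy
  simp [h', (chartAt Plane p).right_inv hy]

theorem mfderiv_chart_self (p : M) :
    (mfderiv 𝓘(ℝ, Plane) 𝓘(ℝ, Plane) (chartAt Plane p) p : Plane →L[ℝ] Plane) =
      ContinuousLinearMap.id ℝ Plane := by
  have : IsManifold 𝓘(ℝ, Plane) 1 M := IsManifold.of_le (n := ∞) (by simp)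
  have h5 := (mdifferentiable_chart (I := 𝓘(ℝ, Plane)) p).symm_comp_deriv (x := p)
    (mem_chart_source Plane p)
  have h6 : (chartSymmDeriv p (chartAt Plane p p)).comp
    (mfderiv 𝓘(ℝ, Plane) 𝓘(ℝ, Plane) (chartAt Plane p) p : Plane →L[ℝ] Plane) =
      ContinuousLinearMap.id ℝ Plane := h5
  rw [chartSymmDeriv_self] at h6
  exact h6

theorem VForm.inChart_self (α : VForm M V) (p : M) :
    α.inChart p (chartAt Plane p p) = α p := by
  have h' : (chartAt Plane p).symm (chartAt Plane p p) = p :=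
    (chartAt Plane p).left_inv (mem_chart_source Plane p)
  simp [VForm.inChart, chartSymmDeriv_self, h']

theorem OneForm.d_eq (α : OneForm M) : α.d = VForm.d (V := ℝ) α := by
  funext p u v
  have h : ∀ w : TangentSpace 𝓘(ℝ, Plane) p,
      mfderiv 𝓘(ℝ, Plane) 𝓘(ℝ, Plane) (chartAt Plane p) p w = w := fun w =>
    congrArg (fun A : Plane →L[ℝ] Plane => A w) (mfderiv_chart_self p)
  change fderiv ℝ (α.inChart p) (chartAt Plane p p)
      (mfderiv 𝓘(ℝ, Plane) 𝓘(ℝ, Plane) (chartAt Plane p) p u)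
      (mfderiv 𝓘(ℝ, Plane) 𝓘(ℝ, Plane) (chartAt Plane p) p v) -
    fderiv ℝ (α.inChart p) (chartAt Plane p p)
      (mfderiv 𝓘(ℝ, Plane) 𝓘(ℝ, Plane) (chartAt Plane p) p v)
      (mfderiv 𝓘(ℝ, Plane) 𝓘(ℝ, Plane) (chartAt Plane p) p u) = _
  erw [h u, h v]
  rfl

theorem contDiffOn_comp_chart_symm {g : M → V} (hg : ContMDiff 𝓘(ℝ, Plane) 𝓘(ℝ, V) ∞ g) (p : M) :
    ContDiffOn ℝ ∞ (g ∘ (chartAt Plane p).symm) (chartAt Plane p).target :=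
  (hg.comp_contMDiffOn (contMDiffOn_chart_symm (I := 𝓘(ℝ, Plane)) (n := ∞))).contDiffOn

theorem vdiff_inChart {g : M → V} (hg : ContMDiff 𝓘(ℝ, Plane) 𝓘(ℝ, V) ∞ g) (p : M) {y : Plane}
    (hy : y ∈ (chartAt Plane p).target) :
    (vdiff g).inChart p y = fderiv ℝ (g ∘ (chartAt Plane p).symm) y :=
  (hasMFDerivAt_comp_chart_symm p hy
    (hg.mdifferentiable (by simp) _).hasMFDerivAt).fderiv.symm

theorem vdiff_isSmooth {g : M → V} (hg : ContMDiff 𝓘(ℝ, Plane) 𝓘(ℝ, V) ∞ g) :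
    (vdiff g).IsSmooth := fun p =>
  ((contDiffOn_infty_iff_fderiv_of_isOpen (chartAt Plane p).open_target).1
    (contDiffOn_comp_chart_symm hg p)).2.congr fun _ hy => vdiff_inChart hg p hy

theorem vdiff_eq_fderiv {g : M → V} {p : M} (hg : MDifferentiableAt 𝓘(ℝ, Plane) 𝓘(ℝ, V) g p) :
    vdiff g p = fderiv ℝ (g ∘ (chartAt Plane p).symm) (chartAt Plane p p) := by
  have h' : (chartAt Plane p).symm (chartAt Plane p p) = p :=
    (chartAt Plane p).left_inv (mem_chart_source Plane p)
  have := hasMFDerivAt_comp_chart_symm p (mem_chart_target Plane p) (g := g) (L := vdiff g p)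
    (by rw [h']; exact hg.hasMFDerivAt)
  rw [this.fderiv, chartSymmDeriv_self, ContinuousLinearMap.comp_id]

theorem VForm.d_vdiff {g : M → V} (hg : ContMDiff 𝓘(ℝ, Plane) 𝓘(ℝ, V) ∞ g) (p : M)
    (u v : Plane) : (vdiff g).d p u v = 0 := by
  have h1 : (vdiff g).inChart p =ᶠ[nhds (chartAt Plane p p)]
      fderiv ℝ (g ∘ (chartAt Plane p).symm) := by
    filter_upwards [chart_target_mem_nhds p] with y hy using vdiff_inChart hg p hy
  have h2 := ((contDiffOn_comp_chart_symm hg p).contDiffAt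
    (chart_target_mem_nhds p)).isSymmSndFDerivAt minSmoothness_two_le_infty
  rw [VForm.d, h1.fderiv_eq, h2 u v, sub_self]

omit [IsManifold 𝓘(ℝ, Plane) ∞ M] in
theorem VForm.IsSmooth.differentiableAt {α : VForm M V} (hα : α.IsSmooth) (p : M) :
    DifferentiableAt ℝ (α.inChart p) (chartAt Plane p p) :=
  ((hα p).contDiffAt (chart_target_mem_nhds p)).differentiableAt (by simp)

theorem VForm.IsSmooth.clm_comp {α : VForm M V} (hα : α.IsSmooth) {L : M → V →L[ℝ] W}
    (hL : ContMDiff 𝓘(ℝ, Plane) 𝓘(ℝ, V →L[ℝ] W) ∞ L) :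
    VForm.IsSmooth (fun p => (L p).comp (α p)) := fun p =>
  (contDiffOn_comp_chart_symm hL p).clm_comp (hα p)

/-- The Leibniz rule `d(Lα) = L dα + dL ∧ α`. The structure equations and the closedness of `A ∘ df`
both come from it. -/
theorem VForm.d_clm_comp {α : VForm M V} (hα : α.IsSmooth) {L : M → V →L[ℝ] W}
    (hL : ContMDiff 𝓘(ℝ, Plane) 𝓘(ℝ, V →L[ℝ] W) ∞ L) (p : M) (u v : Plane) :
    VForm.d (fun q => (L q).comp (α q)) p u v =
      L p (α.d p u v) + (vdiff L p u (α p v) - vdiff L p v (α p u)) := by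
  have h' : (chartAt Plane p).symm (chartAt Plane p p) = p :=
    (chartAt Plane p).left_inv (mem_chart_source Plane p)
  have hL' : DifferentiableAt ℝ (L ∘ (chartAt Plane p).symm) (chartAt Plane p p) :=
    ((contDiffOn_comp_chart_symm hL p).contDiffAt (chart_target_mem_nhds p)).differentiableAt
      (by simp)
  have h1 : VForm.inChart (fun q => (L q).comp (α q)) p =
      fun y => ((L ∘ (chartAt Plane p).symm) y).comp (α.inChart p y) := rfl
  have h2 := (hL'.hasFDerivAt.clm_comp (hα.differentiableAt p).hasFDerivAt).fderiv
  rw [VForm.d, h1, h2, VForm.d, vdiff_eq_fderiv (hL.mdifferentiable (by simp) p)]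
  simp only [VForm.inChart_self, Function.comp_apply, h', add_apply,
    ContinuousLinearMap.comp_apply, ContinuousLinearMap.compL_apply,
    ContinuousLinearMap.flip_apply, map_sub]
  abel

omit [IsManifold 𝓘(ℝ, Plane) ∞ M] in
theorem VForm.inChart_sum {ι : Type*} (s : Finset ι) (α : ι → VForm M V) (p : M) :
    VForm.inChart (fun q => ∑ i ∈ s, α i q) p = fun y => ∑ i ∈ s, (α i).inChart p y := by
  funext y
  simp [VForm.inChart, ContinuousLinearMap.finsetSum_comp]

omit [IsManifold 𝓘(ℝ, Plane) ∞ M] in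
theorem VForm.IsSmooth.sum {ι : Type*} {s : Finset ι} {α : ι → VForm M V}
    (hα : ∀ i ∈ s, (α i).IsSmooth) : VForm.IsSmooth (fun q => ∑ i ∈ s, α i q) := fun p => by
  rw [VForm.inChart_sum]
  exact ContDiffOn.sum fun i hi => hα i hi p

/-- Closedness at a point can be read off in any chart around this point. -/
theorem VForm.fderiv_inChart_symm_of_closed {α : VForm M V} (hα : α.IsSmooth)
    (hd : ∀ p u v, α.d p u v = 0) (p : M) {y : Plane} (hy : y ∈ (chartAt Plane p).target)
    (u v : Plane) :
    fderiv ℝ (α.inChart p) y u v = fderiv ℝ (α.inChart p) y v u := by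
  set q := (chartAt Plane p).symm y with hq
  set τ : Plane → Plane := (chartAt Plane q) ∘ (chartAt Plane p).symm with hτ
  have hτy : τ y = chartAt Plane q q := rfl
  set S := (chartAt Plane p).target ∩ (chartAt Plane p).symm ⁻¹' (chartAt Plane q).source with hS
  have hSo : IsOpen S := (chartAt Plane p).isOpen_inter_preimage_symm (chartAt Plane q).open_source
  have hyS : y ∈ S := ⟨hy, mem_chart_source Plane q⟩
  have hτs : ContDiffOn ℝ ∞ τ S :=
    ((contMDiffOn_chart (I := 𝓘(ℝ, Plane)) (n := ∞) (x := q)).comp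
      ((contMDiffOn_chart_symm (I := 𝓘(ℝ, Plane)) (n := ∞) (x := p)).mono inter_subset_left)
      (fun z hz => hz.2)).contDiffOn
  -- The hypothesis at `q` speaks of the chart around `q`, the goal of the chart around `p`. The two
  -- expressions are related by pull-back under the transition map `τ`; differentiating adds a term
  -- with the second derivative of `τ`, which is symmetric and cancels.
  have key : ∀ z ∈ S, α.inChart p z = (α.inChart q (τ z)).comp (fderiv ℝ τ z) := by
    intro z hz
    have h1 : (chartAt Plane q).symm (τ z) = (chartAt Plane p).symm z :=
      (chartAt Plane q).left_inv hz.2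
    have h2 : τ z ∈ (chartAt Plane q).target := (chartAt Plane q).map_source hz.2
    have : IsManifold 𝓘(ℝ, Plane) 1 M := IsManifold.of_le (n := ∞) (by simp)
    have h3 := (mdifferentiableAt_atlas_symm (I := 𝓘(ℝ, Plane)) (chart_mem_atlas Plane q)
      h2).hasMFDerivAt
    have h4 : HasMFDerivAt 𝓘(ℝ, Plane) 𝓘(ℝ, Plane) τ z (fderiv ℝ τ z) :=
      (((hτs.contDiffAt (hSo.mem_nhds hz)).differentiableAt (by simp)).hasFDerivAt).hasMFDerivAt
    have h5 := h3.comp z h4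
    have h6 : HasMFDerivAt 𝓘(ℝ, Plane) 𝓘(ℝ, Plane) (chartAt Plane p).symm z
        ((chartSymmDeriv q (τ z)).comp (fderiv ℝ τ z)) := by
      refine h5.congr_of_eventuallyEq ?_
      filter_upwards [hSo.mem_nhds hz] with w hw
      exact ((chartAt Plane q).left_inv hw.2).symm
    have h7 : chartSymmDeriv p z = (chartSymmDeriv q (τ z)).comp (fderiv ℝ τ z) := h6.mfderiv
    simp only [VForm.inChart, h7, h1, ContinuousLinearMap.comp_assoc]
  have hev : α.inChart p =ᶠ[nhds y] fun z => (α.inChart q (τ z)).comp (fderiv ℝ τ z) := by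
    filter_upwards [hSo.mem_nhds hyS] with z hz using key z hz
  have hτ1 : DifferentiableAt ℝ τ y :=
    (hτs.contDiffAt (hSo.mem_nhds hyS)).differentiableAt (by simp)
  have hτ2 : DifferentiableAt ℝ (fderiv ℝ τ) y :=
    (((contDiffOn_infty_iff_fderiv_of_isOpen hSo).1 hτs).2.contDiffAt
      (hSo.mem_nhds hyS)).differentiableAt (by simp)
  have hsymm := (hτs.contDiffAt (hSo.mem_nhds hyS)).isSymmSndFDerivAt minSmoothness_two_le_infty
  have hα1 : HasFDerivAt (α.inChart q) (fderiv ℝ (α.inChart q) (τ y)) (τ y) :=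
    (hα.differentiableAt q).hasFDerivAt
  have hder := ((hα1.comp y hτ1.hasFDerivAt).clm_comp hτ2.hasFDerivAt).fderiv
  have hdq := fun a b => sub_eq_zero.1 (hd q a b)
  rw [hev.fderiv_eq]
  change fderiv ℝ (fun z => ((α.inChart q ∘ τ) z).comp (fderiv ℝ τ z)) y u v =
    fderiv ℝ (fun z => ((α.inChart q ∘ τ) z).comp (fderiv ℝ τ z)) y v u
  rw [hder]
  simp only [add_apply, ContinuousLinearMap.comp_apply, ContinuousLinearMap.compL_apply,
    ContinuousLinearMap.flip_apply, hsymm u v]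
  rw [hτy, hdq]

end FormCalculus

/-! ### Closed forms on simply connected surfaces are exact. -/

section Poincare

variable {M : Type*} [TopologicalSpace M] [ChartedSpace Plane M] [IsManifold 𝓘(ℝ, Plane) ∞ M]
variable {V : Type*} [NormedAddCommGroup V] [NormedSpace ℝ V]

theorem exists_local_primitive [CompleteSpace V] {α : VForm M V} (hα : α.IsSmooth)
    (hd : ∀ p u v, α.d p u v = 0) (p : M) :
    ∃ U : Set M, IsOpen U ∧ p ∈ U ∧ ∃ g : M → V, ∀ q ∈ U,
      HasMFDerivAt 𝓘(ℝ, Plane) 𝓘(ℝ, V) g q (α q) := by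
  set c := chartAt Plane p
  obtain ⟨r, hr, hrs⟩ := Metric.mem_nhds_iff.1 (chart_target_mem_nhds p)
  obtain ⟨g, hg⟩ := (convex_ball (c p) r).exists_forall_hasFDerivAt_of_fderiv_symmetric
    Metric.isOpen_ball (((hα p).mono hrs).differentiableOn (by simp))
    (fun a ha u v => VForm.fderiv_inChart_symm_of_closed hα hd p (hrs ha) u v)
  refine ⟨c.source ∩ c ⁻¹' Metric.ball (c p) r, c.isOpen_inter_preimage Metric.isOpen_ball,
    ⟨mem_chart_source Plane p, Metric.mem_ball_self hr⟩, g ∘ c, fun q hq => ?_⟩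
  have h1 : HasFDerivAt ((g ∘ c) ∘ c.symm) ((α (c.symm (c q))).comp (chartSymmDeriv p (c q)))
      (c q) := by
    refine (hg (c q) hq.2).congr_of_eventuallyEq ?_
    filter_upwards [Metric.isOpen_ball.mem_nhds hq.2] with y hy
    simp [c.right_inv (hrs hy)]
  have h2 := hasMFDerivAt_of_comp_chart_symm p (hrs hq.2) h1
  have h3 : c.symm (c q) = q := c.left_inv hq.1
  exact h3 ▸ h2

theorem eventually_eq_of_hasMFDerivAt_zero {h : M → V} {U : Set M} (hU : IsOpen U)
    (hh : ∀ q ∈ U, HasMFDerivAt 𝓘(ℝ, Plane) 𝓘(ℝ, V) h q (0 : Plane →L[ℝ] V)) {p : M}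
    (hp : p ∈ U) : ∀ᶠ q in nhds p, h q = h p := by
  set c := chartAt Plane p
  have hS : c.target ∩ c.symm ⁻¹' U ∈ nhds (c p) :=
    (c.isOpen_inter_preimage_symm hU).mem_nhds
      ⟨mem_chart_target Plane p, by simpa [c] using hp⟩
  obtain ⟨r, hr, hrs⟩ := Metric.mem_nhds_iff.1 hS
  have h0 : ∀ y ∈ Metric.ball (c p) r, HasFDerivAt (h ∘ c.symm) (0 : Plane →L[ℝ] V) y := by
    intro y hy
    simpa using hasMFDerivAt_comp_chart_symm p (hrs hy).1 (hh _ (hrs hy).2)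
  have hW : c.source ∩ c ⁻¹' Metric.ball (c p) r ∈ nhds p :=
    (c.isOpen_inter_preimage Metric.isOpen_ball).mem_nhds
      ⟨mem_chart_source Plane p, Metric.mem_ball_self hr⟩
  filter_upwards [hW] with q hq
  have := (convex_ball (c p) r).is_const_of_fderivWithin_eq_zero (𝕜 := ℝ) (f := h ∘ c.symm)
    (fun y hy => (h0 y hy).differentiableAt.differentiableWithinAt)
    (fun y hy => (h0 y hy).hasFDerivWithinAt.fderivWithin
      (Metric.isOpen_ball.uniqueDiffWithinAt hy)) hq.2 (Metric.mem_ball_self hr)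
  simpa [c.left_inv hq.1, c] using this

/-- A type with the discrete topology. -/
def DiscreteCopy (V : Type*) := V

instance (V : Type*) : TopologicalSpace (DiscreteCopy V) := ⊥

instance (V : Type*) : DiscreteTopology (DiscreteCopy V) := ⟨rfl⟩

/-- The bundle of germs of primitives of a 1-form, for a family of local primitives. -/
def primitiveBundle {U : M → Set M} (hU : ∀ p, IsOpen (U p)) (hpU : ∀ p, p ∈ U p)
    {α : VForm M V} {g : M → M → V}
    (hg : ∀ p, ∀ q ∈ U p, HasMFDerivAt 𝓘(ℝ, Plane) 𝓘(ℝ, V) (g p) q (α q)) :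
    FiberBundleCore M M (DiscreteCopy V) where
  baseSet := U
  isOpen_baseSet := hU
  indexAt := id
  mem_baseSet_at := hpU
  -- The coordinate `v` over `i` stands for the germ at `x` of the primitive `g i + v`; this is the
  -- constant to be added to `g j` to obtain the same germ.
  coordChange i j x v := (show V from v) + (g i x - g j x)
  coordChange_self i x _ v := by
    change (show V from v) + (g i x - g i x) = v
    rw [sub_self, add_zero]
  continuousOn_coordChange i j := by
    rintro ⟨x, v⟩ ⟨hx, -⟩
    refine ContinuousAt.continuousWithinAt ?_
    -- Two primitives of `α` differ by a locally constant function, which is what continuity into a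
    -- discrete fibre requires.
    have h1 : ∀ᶠ q in nhds x, g i q - g j q = g i x - g j x :=
      eventually_eq_of_hasMFDerivAt_zero ((hU i).inter (hU j)) (h := fun q => g i q - g j q)
        (fun q hq => by
          exact (sub_self (α q : Plane →L[ℝ] V)) ▸ (hg i q hq.1).sub (hg j q hq.2)) hx
    have h2 : ∀ᶠ w in nhds v, w = v := by simp
    have h3 : ∀ᶠ z : M × DiscreteCopy V in nhds (x, v),
        ((show V from v) + (g i x - g j x) : DiscreteCopy V) =
          (show V from z.2) + (g i z.1 - g j z.1) := by
      rw [nhds_prod_eq]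
      filter_upwards [h1.prod_mk h2] with z hz
      rw [hz.1, hz.2]
    exact continuousAt_const.congr h3
  coordChange_comp i j k x _ v := by
    change (show V from v) + (g i x - g j x) + (g j x - g k x) = (show V from v) + (g i x - g k x)
    abel

/-- On a simply connected surface, closed 1-forms are exact. -/
theorem exists_vdiff_eq_of_closed [CompleteSpace V] [SimplyConnectedSpace M] {α : VForm M V}
    (hα : α.IsSmooth) (hd : ∀ p u v, α.d p u v = 0) :
    ∃ g : M → V, ContMDiff 𝓘(ℝ, Plane) 𝓘(ℝ, V) ∞ g ∧ ∀ p, vdiff g p = α p := by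
  choose U hU hpU g hg using exists_local_primitive hα hd
  set Z := primitiveBundle hU hpU hg with hZ
  have : LocallyPathConnectedSpace M := ChartedSpace.locallyPathConnectedSpace Plane M
  obtain ⟨p₀⟩ : Nonempty M := inferInstance
  -- The discrete fibre makes the bundle a covering. As `M` is simply connected, the identity lifts:
  -- a global section is a coherent choice of germs of primitives.
  obtain ⟨s, ⟨-, hs⟩, -⟩ := (FiberBundle.isCoveringMap (F := DiscreteCopy V)
    (E := Z.Fiber)).existsUnique_continuousMap_lifts (ContinuousMap.id M) p₀
    (⟨p₀, (0 : V)⟩ : Bundle.TotalSpace (DiscreteCopy V) Z.Fiber) rfl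
  have hs' : ∀ q, (s q).proj = q := fun q => congrFun hs q
  -- The value at `q` of the germ chosen there: the fibre coordinate over `q` refers to the
  -- primitive indexed by `q` itself.
  set h : M → V := fun q => (show V from (s q).snd) + g q q with hh
  have hder : ∀ q, HasMFDerivAt 𝓘(ℝ, Plane) 𝓘(ℝ, V) h q (α q) := by
    intro i
    have hcont : ContinuousAt (fun q => (Z.localTriv i (s q)).2) i := by
      have h1 : ContinuousAt (Z.localTriv i) (s i) :=
        (Z.localTriv i).continuousAt ((Z.localTriv i).mem_source.2 (by
          change (s i).proj ∈ U i
          rw [hs']; exact hpU i))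
      exact continuous_snd.continuousAt.comp (h1.comp s.continuous.continuousAt)
    have hev : ∀ᶠ q in nhds i, (Z.localTriv i (s q)).2 = (Z.localTriv i (s i)).2 :=
      hcont.eventually (by simp : ∀ᶠ w in nhds (Z.localTriv i (s i)).2,
        w = (Z.localTriv i (s i)).2)
    have hval : ∀ q, (Z.localTriv i (s q)).2 = h q - g i q := by
      intro q
      have : (Z.localTriv i (s q)).2 =
        (show V from (s q).snd) + (g (s q).proj (s q).proj - g i (s q).proj) := rfl
      rw [this, hs' q, hh]
      exact (add_sub_assoc (show V from (s q).snd) (g q q) (g i q)).symm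
    have hev' : h =ᶠ[nhds i] fun q => g i q + (h i - g i i) := by
      filter_upwards [hev] with q hq
      rw [hval, hval] at hq
      have hq' : h q - g i q = h i - g i i := hq
      rw [← hq']
      abel
    have h2 : HasMFDerivAt 𝓘(ℝ, Plane) 𝓘(ℝ, V) (fun q => g i q + (h i - g i i)) i (α i) := by
      exact (add_zero (α i : Plane →L[ℝ] V)) ▸
        (hg i i (hpU i)).add (hasMFDerivAt_const (I := 𝓘(ℝ, Plane)) (h i - g i i) i)
    exact h2.congr_of_eventuallyEq hev'
  refine ⟨h, fun p => ?_, fun p => (hder p).mfderiv⟩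
  set c := chartAt Plane p
  have h1 : ∀ y ∈ c.target, HasFDerivAt (h ∘ c.symm) (α.inChart p y) y := fun y hy =>
    hasMFDerivAt_comp_chart_symm p hy (hder _)
  have h2 : ContDiffOn ℝ ∞ (h ∘ c.symm) c.target :=
    (contDiffOn_infty_iff_fderiv_of_isOpen c.open_target).2
      ⟨fun y hy => (h1 y hy).differentiableAt.differentiableWithinAt,
        (hα p).congr fun y hy => (h1 y hy).fderiv⟩
  have h3 : ContMDiffAt 𝓘(ℝ, Plane) 𝓘(ℝ, V) ∞ (h ∘ c.symm) (c p) :=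
    (h2.contDiffAt (chart_target_mem_nhds p)).contMDiffAt
  have h4 : ContMDiffAt 𝓘(ℝ, Plane) 𝓘(ℝ, Plane) ∞ c p :=
    (contMDiffOn_chart (I := 𝓘(ℝ, Plane)) (n := ∞)).contMDiffAt (chart_source_mem_nhds Plane p)
  refine (h3.comp p h4).congr_of_eventuallyEq ?_
  filter_upwards [chart_source_mem_nhds Plane p] with q hq
  simp [c, (chartAt Plane p).left_inv hq]

theorem eq_of_vdiff_eq_zero [PreconnectedSpace M] {h : M → V}
    (hh : ContMDiff 𝓘(ℝ, Plane) 𝓘(ℝ, V) ∞ h) (h0 : ∀ p, vdiff h p = 0) (p q : M) : h p = h q := by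
  refine IsLocallyConstant.apply_eq_of_preconnectedSpace ?_ p q
  refine (IsLocallyConstant.iff_eventually_eq h).2 fun x => ?_
  refine eventually_eq_of_hasMFDerivAt_zero isOpen_univ (fun q _ => ?_) (mem_univ x)
  rw [← h0 q]
  exact (hh.mdifferentiable (by simp) q).hasMFDerivAt

end Poincare

/-! ### One-parameter families of maps: smoothness and variation. -/

section Families

variable {M : Type*} [TopologicalSpace M] [ChartedSpace Plane M] [IsManifold 𝓘(ℝ, Plane) ∞ M]
variable {V W Z : Type*} [NormedAddCommGroup V] [NormedSpace ℝ V]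
  [NormedAddCommGroup W] [NormedSpace ℝ W] [NormedAddCommGroup Z] [NormedSpace ℝ Z]

theorem vdiff_bilinear (B : V →L[ℝ] W →L[ℝ] Z) {g : M → V} {h : M → W}
    (hg : ContMDiff 𝓘(ℝ, Plane) 𝓘(ℝ, V) ∞ g) (hh : ContMDiff 𝓘(ℝ, Plane) 𝓘(ℝ, W) ∞ h)
    (p : M) (u : Plane) :
    vdiff (fun q => B (g q) (h q)) p u = B (vdiff g p u) (h p) + B (g p) (vdiff h p u) := by
  have h' : (chartAt Plane p).symm (chartAt Plane p p) = p :=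
    (chartAt Plane p).left_inv (mem_chart_source Plane p)
  have hg' := ((contDiffOn_comp_chart_symm hg p).contDiffAt
    (chart_target_mem_nhds p)).differentiableAt (by simp)
  have hh' := ((contDiffOn_comp_chart_symm hh p).contDiffAt
    (chart_target_mem_nhds p)).differentiableAt (by simp)
  have hB : ContMDiff 𝓘(ℝ, Plane) 𝓘(ℝ, Z) ∞ (fun q => B (g q) (h q)) :=
    (B.contDiff.contMDiff.comp hg).clm_apply hh
  rw [vdiff_eq_fderiv (hg.mdifferentiable (by simp) p),
    vdiff_eq_fderiv (hh.mdifferentiable (by simp) p),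
    vdiff_eq_fderiv (hB.mdifferentiable (by simp) p)]
  have := (B.hasFDerivAt_of_bilinear hg'.hasFDerivAt hh'.hasFDerivAt).fderiv
  change fderiv ℝ (fun y => B ((g ∘ (chartAt Plane p).symm) y) ((h ∘ (chartAt Plane p).symm) y))
    (chartAt Plane p p) u = _
  rw [this]
  simp [h', add_comm]

omit [IsManifold 𝓘(ℝ, Plane) ∞ M] in
theorem vdiff_clm (L : V →L[ℝ] W) {g : M → V} (hg : ContMDiff 𝓘(ℝ, Plane) 𝓘(ℝ, V) ∞ g)
    (p : M) (u : Plane) : vdiff (fun q => L (g q)) p u = L (vdiff g p u) := by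
  have h1 : HasMFDerivAt 𝓘(ℝ, Plane) 𝓘(ℝ, W) (L ∘ g) p (L.comp (vdiff g p)) :=
    L.hasMFDerivAt.comp p (hg.mdifferentiable (by simp) p).hasMFDerivAt
  exact congrArg (fun A : Plane →L[ℝ] W => A u) h1.mfderiv

/-- The differential of the chart around `p`. -/
def chartDeriv (p q : M) : Plane →L[ℝ] Plane :=
  mfderiv 𝓘(ℝ, Plane) 𝓘(ℝ, Plane) (chartAt Plane p) q

theorem chartDeriv_self (p : M) : chartDeriv p p = ContinuousLinearMap.id ℝ Plane :=
  mfderiv_chart_self p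

/-- The family `F` of maps in the chart around `p`. -/
def chartFamily (F : ℝ → M → V) (p : M) (z : ℝ × Plane) : V :=
  F z.1 ((chartAt Plane p).symm z.2)

/-- The domain of a family of maps in the chart around `p`. -/
def chartDomain (D : Set (ℝ × M)) (p : M) : Set (ℝ × Plane) :=
  (univ ×ˢ (chartAt Plane p).target) ∩ (fun z => (z.1, (chartAt Plane p).symm z.2)) ⁻¹' D

omit [IsManifold 𝓘(ℝ, Plane) ∞ M] in
theorem isOpen_chartDomain {D : Set (ℝ × M)} (hD : IsOpen D) (p : M) :
    IsOpen (chartDomain D p) := by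
  refine ContinuousOn.isOpen_inter_preimage ?_ (isOpen_univ.prod (chartAt Plane p).open_target) hD
  exact continuousOn_fst.prodMk
    ((chartAt Plane p).continuousOn_symm.comp continuousOn_snd fun z hz => hz.2)

variable {D : Set (ℝ × M)} {F : ℝ → M → V}

theorem contDiffOn_chartFamily
    (hF : ContMDiffOn (𝓘(ℝ, ℝ).prod 𝓘(ℝ, Plane)) 𝓘(ℝ, V) ∞ (fun q : ℝ × M => F q.1 q.2) D)
    (p : M) : ContDiffOn ℝ ∞ (chartFamily F p) (chartDomain D p) := by
  have h1 : ContMDiffOn 𝓘(ℝ, ℝ × Plane) 𝓘(ℝ, ℝ) ∞ (fun z : ℝ × Plane => z.1) (chartDomain D p) :=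
    contDiff_fst.contMDiff.contMDiffOn
  have h2 : ContMDiffOn 𝓘(ℝ, ℝ × Plane) 𝓘(ℝ, Plane) ∞
      (fun z : ℝ × Plane => (chartAt Plane p).symm z.2) (chartDomain D p) :=
    (contMDiffOn_chart_symm (I := 𝓘(ℝ, Plane)) (n := ∞) (x := p)).comp
      contDiff_snd.contMDiff.contMDiffOn fun z hz => hz.1.2
  exact (hF.comp (h1.prodMk h2) fun z hz => hz.2).contDiffOn

omit [IsManifold 𝓘(ℝ, Plane) ∞ M] in
theorem chart_mem_chartDomain {t : ℝ} {p q : M} (h : (t, q) ∈ D)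
    (hq : q ∈ (chartAt Plane p).source) : (t, chartAt Plane p q) ∈ chartDomain D p :=
  ⟨⟨mem_univ _, (chartAt Plane p).map_source hq⟩, by
    simpa [(chartAt Plane p).left_inv hq] using h⟩

theorem contDiffOn_fderiv_chartFamily (hD : IsOpen D)
    (hF : ContMDiffOn (𝓘(ℝ, ℝ).prod 𝓘(ℝ, Plane)) 𝓘(ℝ, V) ∞ (fun q : ℝ × M => F q.1 q.2) D)
    (p : M) : ContDiffOn ℝ ∞ (fderiv ℝ (chartFamily F p)) (chartDomain D p) :=
  ((contDiffOn_infty_iff_fderiv_of_isOpen (isOpen_chartDomain hD p)).1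
    (contDiffOn_chartFamily hF p)).2

theorem hasFDerivAt_chartFamily (hD : IsOpen D)
    (hF : ContMDiffOn (𝓘(ℝ, ℝ).prod 𝓘(ℝ, Plane)) 𝓘(ℝ, V) ∞ (fun q : ℝ × M => F q.1 q.2) D)
    {p : M} {z : ℝ × Plane} (hz : z ∈ chartDomain D p) :
    HasFDerivAt (chartFamily F p) (fderiv ℝ (chartFamily F p) z) z :=
  (((contDiffOn_chartFamily hF p).contDiffAt
    ((isOpen_chartDomain hD p).mem_nhds hz)).differentiableAt (by simp)).hasFDerivAt

/-- A single chart serves all `q` near `p`, so the joint smoothness of the differential in `(t, q)`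
becomes visible; `chartDeriv p q` accounts for `q ≠ p`. -/
theorem vdiff_family_eq (hD : IsOpen D)
    (hF : ContMDiffOn (𝓘(ℝ, ℝ).prod 𝓘(ℝ, Plane)) 𝓘(ℝ, V) ∞ (fun q : ℝ × M => F q.1 q.2) D)
    {t : ℝ} {p q : M} (h : (t, q) ∈ D) (hq : q ∈ (chartAt Plane p).source) :
    vdiff (F t) q = (fderiv ℝ (chartFamily F p) (t, chartAt Plane p q)).comp
      ((ContinuousLinearMap.inr ℝ ℝ Plane).comp (chartDeriv p q)) := by
  have : IsManifold 𝓘(ℝ, Plane) 1 M := IsManifold.of_le (n := ∞) (by simp)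
  set c := chartAt Plane p
  have h1 := hasFDerivAt_chartFamily hD hF (chart_mem_chartDomain h hq)
  have h2 : HasFDerivAt (fun y : Plane => (t, y)) (ContinuousLinearMap.inr ℝ ℝ Plane) (c q) :=
    hasFDerivAt_prodMk_right t (c q)
  have h3 : HasMFDerivAt 𝓘(ℝ, Plane) 𝓘(ℝ, V) (fun y => chartFamily F p (t, y)) (c q) _ :=
    (h1.comp (c q) h2).hasMFDerivAt
  have h4 := h3.comp q ((mdifferentiableAt_atlas (I := 𝓘(ℝ, Plane))
    (chart_mem_atlas Plane p) hq).hasMFDerivAt)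
  have h5 := h4.congr_of_eventuallyEq (f₁ := F t) (by
    filter_upwards [c.open_source.mem_nhds hq] with x hx
    simp [chartFamily, c, (chartAt Plane p).left_inv hx])
  exact h5.mfderiv

theorem vdiff_family_eq_self (hD : IsOpen D)
    (hF : ContMDiffOn (𝓘(ℝ, ℝ).prod 𝓘(ℝ, Plane)) 𝓘(ℝ, V) ∞ (fun q : ℝ × M => F q.1 q.2) D)
    {t : ℝ} {p : M} (h : (t, p) ∈ D) :
    vdiff (F t) p = (fderiv ℝ (chartFamily F p) (t, chartAt Plane p p)).comp
      (ContinuousLinearMap.inr ℝ ℝ Plane) := by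
  rw [vdiff_family_eq hD hF h (mem_chart_source Plane p), chartDeriv_self,
    ContinuousLinearMap.comp_id]

theorem contMDiffOn_vdiff_family (hD : IsOpen D)
    (hF : ContMDiffOn (𝓘(ℝ, ℝ).prod 𝓘(ℝ, Plane)) 𝓘(ℝ, V) ∞ (fun q : ℝ × M => F q.1 q.2) D)
    {X : ℝ → ∀ p : M, TangentSpace 𝓘(ℝ, Plane) p}
    (hX : ContMDiffOn (𝓘(ℝ, ℝ).prod 𝓘(ℝ, Plane)) 𝓘(ℝ, Plane).tangent ∞
      (fun q : ℝ × M => (⟨q.2, X q.1 q.2⟩ : TangentBundle 𝓘(ℝ, Plane) M)) D) :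
    ContMDiffOn (𝓘(ℝ, ℝ).prod 𝓘(ℝ, Plane)) 𝓘(ℝ, V) ∞
      (fun q : ℝ × M => vdiff (F q.1) q.2 (X q.1 q.2)) D := by
  have : IsManifold 𝓘(ℝ, Plane) 1 M := IsManifold.of_le (n := ∞) (by simp)
  rintro ⟨t₀, p⟩ h₀
  refine ContMDiffAt.contMDiffWithinAt ?_
  set c := chartAt Plane p
  have hX₀ := (Bundle.contMDiffAt_totalSpace.1 (hX.contMDiffAt (hD.mem_nhds h₀))).2
  have hsrc : ∀ᶠ q : ℝ × M in nhds (t₀, p), q.2 ∈ c.source :=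
    continuousAt_snd.eventually (chart_source_mem_nhds Plane p)
  have hc : ContMDiffAt (𝓘(ℝ, ℝ).prod 𝓘(ℝ, Plane)) 𝓘(ℝ, ℝ × Plane) ∞
      (fun q : ℝ × M => (q.1, c q.2)) (t₀, p) :=
    contMDiffAt_fst.prodMk_space
      (((contMDiffOn_chart (I := 𝓘(ℝ, Plane)) (n := ∞) (x := p)).contMDiffAt
        (chart_source_mem_nhds Plane p)).comp (t₀, p) contMDiffAt_snd)
  have hfd : ContMDiffAt 𝓘(ℝ, ℝ × Plane) 𝓘(ℝ, ℝ × Plane →L[ℝ] V) ∞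
      (fderiv ℝ (chartFamily F p)) (t₀, c p) :=
    ((contDiffOn_fderiv_chartFamily hD hF p).contDiffAt ((isOpen_chartDomain hD p).mem_nhds
      (chart_mem_chartDomain h₀ (mem_chart_source Plane p)))).contMDiffAt
  have hcomp := ((hfd.comp (t₀, p) hc).clm_apply
    ((ContinuousLinearMap.inr ℝ ℝ Plane).contMDiff.contMDiffAt.comp (t₀, p) hX₀))
  refine hcomp.congr_of_eventuallyEq ?_
  filter_upwards [hD.mem_nhds h₀, hsrc] with q hq hqs
  rw [vdiff_family_eq hD hF hq hqs]
  have h6 : (trivializationAt Plane (TangentSpace 𝓘(ℝ, Plane)) p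
      (⟨q.2, X q.1 q.2⟩ : TangentBundle 𝓘(ℝ, Plane) M)).2 =
      chartDeriv p q.2 (X q.1 q.2) := by
    rw [TangentBundle.trivializationAt_apply, chartDeriv, (mdifferentiableAt_atlas
      (I := 𝓘(ℝ, Plane)) (chart_mem_atlas Plane p) hqs).mfderiv]
    rfl
  exact congrArg (fun w => fderiv ℝ (chartFamily F p) (q.1, c q.2)
    (ContinuousLinearMap.inr ℝ ℝ Plane w)) h6.symm

variable (F) in
/-- The variational field of a family of maps. -/
def variation (p : M) : V := deriv (fun t => F t p) 0

theorem hasDerivAt_family (hD : IsOpen D)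
    (hF : ContMDiffOn (𝓘(ℝ, ℝ).prod 𝓘(ℝ, Plane)) 𝓘(ℝ, V) ∞ (fun q : ℝ × M => F q.1 q.2) D)
    {p q : M} (h : (0, q) ∈ D) (hq : q ∈ (chartAt Plane p).source) :
    HasDerivAt (fun t => F t q) (fderiv ℝ (chartFamily F p) (0, chartAt Plane p q) (1, 0)) 0 := by
  have h1 := hasFDerivAt_chartFamily hD hF (chart_mem_chartDomain h hq)
  have h2 : HasDerivAt (fun t : ℝ => (t, chartAt Plane p q)) ((1 : ℝ), (0 : Plane)) 0 :=
    (hasDerivAt_id (0 : ℝ)).prodMk (hasDerivAt_const _ _)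
  have h3 := h1.comp_hasDerivAt (0 : ℝ) h2
  refine h3.congr_of_eventuallyEq (Filter.Eventually.of_forall fun t => ?_)
  simp [chartFamily, (chartAt Plane p).left_inv hq]

theorem hasDerivAt_variation (hD : IsOpen D)
    (hF : ContMDiffOn (𝓘(ℝ, ℝ).prod 𝓘(ℝ, Plane)) 𝓘(ℝ, V) ∞ (fun q : ℝ × M => F q.1 q.2) D)
    {p : M} (h : (0, p) ∈ D) : HasDerivAt (fun t => F t p) (variation F p) 0 :=
  (hasDerivAt_family hD hF h (mem_chart_source Plane p)).differentiableAt.hasDerivAt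

theorem contMDiff_variation (hD : IsOpen D) (hD₀ : ∀ p, ((0 : ℝ), p) ∈ D)
    (hF : ContMDiffOn (𝓘(ℝ, ℝ).prod 𝓘(ℝ, Plane)) 𝓘(ℝ, V) ∞ (fun q : ℝ × M => F q.1 q.2) D) :
    ContMDiff 𝓘(ℝ, Plane) 𝓘(ℝ, V) ∞ (variation F) := by
  intro p
  set c := chartAt Plane p
  have hc : ContMDiffAt 𝓘(ℝ, Plane) 𝓘(ℝ, ℝ × Plane) ∞ (fun q : M => ((0 : ℝ), c q)) p :=
    contMDiffAt_const.prodMk_space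
      ((contMDiffOn_chart (I := 𝓘(ℝ, Plane)) (n := ∞) (x := p)).contMDiffAt
        (chart_source_mem_nhds Plane p))
  have hfd : ContMDiffAt 𝓘(ℝ, ℝ × Plane) 𝓘(ℝ, ℝ × Plane →L[ℝ] V) ∞
      (fderiv ℝ (chartFamily F p)) (0, c p) :=
    ((contDiffOn_fderiv_chartFamily hD hF p).contDiffAt ((isOpen_chartDomain hD p).mem_nhds
      (chart_mem_chartDomain (hD₀ p) (mem_chart_source Plane p)))).contMDiffAt
  have hcomp := (hfd.comp p hc).clm_apply (contMDiffAt_const (c := ((1 : ℝ), (0 : Plane))))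
  refine hcomp.congr_of_eventuallyEq ?_
  filter_upwards [chart_source_mem_nhds Plane p] with q hq
  exact (hasDerivAt_family hD hF (hD₀ q) hq).deriv

/-- The derivatives in the parameter and along the surface commute. -/
theorem hasDerivAt_vdiff (hD : IsOpen D) (hD₀ : ∀ p, ((0 : ℝ), p) ∈ D)
    (hF : ContMDiffOn (𝓘(ℝ, ℝ).prod 𝓘(ℝ, Plane)) 𝓘(ℝ, V) ∞ (fun q : ℝ × M => F q.1 q.2) D)
    (p : M) : HasDerivAt (fun t => vdiff (F t) p) (vdiff (variation F) p) 0 := by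
  set c := chartAt Plane p
  set G := chartFamily F p
  have hz := chart_mem_chartDomain (hD₀ p) (mem_chart_source Plane p)
  have hmem : chartDomain D p ∈ nhds ((0 : ℝ), c p) := (isOpen_chartDomain hD p).mem_nhds hz
  have hGG : HasFDerivAt (fderiv ℝ G) (fderiv ℝ (fderiv ℝ G) (0, c p)) (0, c p) :=
    (((contDiffOn_fderiv_chartFamily hD hF p).contDiffAt hmem).differentiableAt
      (by simp)).hasFDerivAt
  -- The exchange of the two derivatives is this symmetry, used for a vector `(1, 0)` in the
  -- parameter and a vector `(0, u)` along the surface.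
  have hsymm := ((contDiffOn_chartFamily hF p).contDiffAt hmem).isSymmSndFDerivAt
    minSmoothness_two_le_infty
  have h1 : HasDerivAt (fun t : ℝ => fderiv ℝ G (t, c p))
      (fderiv ℝ (fderiv ℝ G) (0, c p) (1, 0)) 0 :=
    hGG.comp_hasDerivAt (0 : ℝ) ((hasDerivAt_id (0 : ℝ)).prodMk (hasDerivAt_const _ _))
  have h2 : HasDerivAt (fun t : ℝ => (fderiv ℝ G (t, c p)).comp (ContinuousLinearMap.inr ℝ ℝ Plane))
      ((fderiv ℝ (fderiv ℝ G) (0, c p) (1, 0)).comp (ContinuousLinearMap.inr ℝ ℝ Plane)) 0 := by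
    simpa using h1.clm_comp (hasDerivAt_const (0 : ℝ) (ContinuousLinearMap.inr ℝ ℝ Plane))
  have h3 : HasFDerivAt (fun y : Plane => fderiv ℝ G (0, y))
      ((fderiv ℝ (fderiv ℝ G) (0, c p)).comp (ContinuousLinearMap.inr ℝ ℝ Plane)) (c p) :=
    hGG.comp (c p) (hasFDerivAt_prodMk_right (0 : ℝ) (c p))
  have h4 := h3.clm_apply (hasFDerivAt_const ((1 : ℝ), (0 : Plane)) (c p))
  have h5 : (variation F ∘ c.symm) =ᶠ[nhds (c p)] fun y => fderiv ℝ G (0, y) (1, 0) := by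
    filter_upwards [chart_target_mem_nhds p] with y hy
    have := (hasDerivAt_family hD hF (p := p) (hD₀ (c.symm y)) (c.map_target hy)).deriv
    rwa [show chartAt Plane p (c.symm y) = y from c.right_inv hy] at this
  have h6 : vdiff (variation F) p =
      (fderiv ℝ (fderiv ℝ G) (0, c p) (1, 0)).comp (ContinuousLinearMap.inr ℝ ℝ Plane) := by
    rw [vdiff_eq_fderiv ((contMDiff_variation hD hD₀ hF).mdifferentiable (by simp) p),
      h5.fderiv_eq, h4.fderiv]
    ext u : 1
    simpa using (hsymm (1, 0) (0, u)).symm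
  rw [h6]
  refine h2.congr_of_eventuallyEq ?_
  have h7 : ∀ᶠ t : ℝ in nhds 0, (t, p) ∈ D :=
    (Continuous.continuousAt (by fun_prop : Continuous fun t : ℝ => (t, p))).eventually
      (hD.mem_nhds (hD₀ p))
  filter_upwards [h7] with t ht
  exact vdiff_family_eq_self hD hF ht

end Families

/-! ### Pairings and skew endomorphisms of ℝ⁴. -/

/-- The endomorphisms of the ambient space. -/
abbrev End4 := Space4 →L[ℝ] Space4

/-- The inner product of the ambient space as a bilinear map. -/
def innerL : Space4 →L[ℝ] Space4 →L[ℝ] ℝ := innerSL ℝ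

theorem innerL_apply (x y : Space4) : innerL x y = inner ℝ x y := rfl

/-- `(x, y) ↦ (S ↦ ⟨x, S y⟩)`. -/
def evalL : Space4 →L[ℝ] Space4 →L[ℝ] End4 →L[ℝ] ℝ :=
  (ContinuousLinearMap.compL ℝ End4 Space4 ℝ).bilinearComp innerL
    (ContinuousLinearMap.apply ℝ Space4)

theorem evalL_apply (x y : Space4) (S : End4) : evalL x y S = inner ℝ x (S y) := rfl

/-- `S` is skew-symmetric. -/
def IsSkew (S : End4) : Prop := ∀ x y, inner ℝ (S x) y = -inner ℝ x (S y)

theorem sum_inner_smul_eq {v : Fin 4 → Space4} (hv : Orthonormal ℝ v) (x : Space4) :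
    ∑ m, inner ℝ (v m) x • v m = x := by
  have h := hv.linearIndependent.span_eq_top_of_card_eq_finrank' (by simp)
  have := (OrthonormalBasis.mk hv h.ge).sum_repr' x
  simpa using this

/-! ### Endomorphism-valued forms read in a frame, and the fundamental system. -/

section Frame

variable {M : Type*} [TopologicalSpace M] [ChartedSpace Plane M]

/-- The components `⟨α(·) ε_k, ε_l⟩` of an endomorphism-valued 1-form with respect to a frame. -/
def frameForm (ε : Fin 4 → M → Space4) (α : VForm M End4) (k l : Fin 4) : OneForm M :=
  fun p => (evalL (ε l p) (ε k p)).comp (α p)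

/-- The connection forms of a frame of the ambient space along the surface. -/
def frameConn (ε : Fin 4 → M → Space4) (k l : Fin 4) : OneForm M :=
  fun p => (innerL (ε l p)).comp (vdiff (ε k) p)

theorem frameForm_apply (ε : Fin 4 → M → Space4) (α : VForm M End4) (k l : Fin 4) (p : M)
    (u : Plane) : frameForm ε α k l p u = inner ℝ (ε l p) (α p u (ε k p)) := rfl

theorem frameConn_apply (ε : Fin 4 → M → Space4) (k l : Fin 4) (p : M)
    (u : Plane) : frameConn ε k l p u = inner ℝ (ε l p) (vdiff (ε k) p u) := rfl

theorem connForm_eq (f : M → Space4) (e : TangentPair M) (ν : NormalPair M) (k l : Fin 4) :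
    connForm f e ν k l = frameConn (eps f e ν) k l := rfl

theorem coframe_apply (f : M → Space4) (e : TangentPair M) (j : Fin 2) (p : M) (u : Plane) :
    coframe f e j p u = inner ℝ (vdiff f p (e j p)) (vdiff f p u) := rfl

variable [IsManifold 𝓘(ℝ, Plane) ∞ M]
variable {ε : Fin 4 → M → Space4}

theorem frameForm_isSmooth (hε : ∀ k, ContMDiff 𝓘(ℝ, Plane) 𝓘(ℝ, Space4) ∞ (ε k))
    {α : VForm M End4} (hα : α.IsSmooth) (k l : Fin 4) :
    VForm.IsSmooth (V := ℝ) (frameForm ε α k l) :=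
  hα.clm_comp ((evalL.contDiff.contMDiff.comp (hε l)).clm_apply (hε k))

theorem frameConn_skew (hε : ∀ k, ContMDiff 𝓘(ℝ, Plane) 𝓘(ℝ, Space4) ∞ (ε k))
    (ho : ∀ p, Orthonormal ℝ fun k => ε k p) (k l : Fin 4) (p : M) (u : Plane) :
    inner ℝ (vdiff (ε l) p u) (ε k p) = -frameConn ε k l p u := by
  have h1 := vdiff_bilinear innerL (hε l) (hε k) p u
  have h2 : (fun q => innerL (ε l q) (ε k q)) = fun _ => if l = k then (1 : ℝ) else 0 := by
    funext q
    exact orthonormal_iff_ite.1 (ho q) l k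
  have h3 : vdiff (fun _ : M => if l = k then (1 : ℝ) else 0) p u = 0 := by
    simp only [vdiff, mfderiv_const]; rfl
  rw [h2, h3] at h1
  rw [frameConn_apply]
  simp only [innerL_apply] at h1
  linarith

/-- The exterior derivatives of the components of an endomorphism-valued 1-form. -/
theorem d_frameForm (hε : ∀ k, ContMDiff 𝓘(ℝ, Plane) 𝓘(ℝ, Space4) ∞ (ε k))
    (ho : ∀ p, Orthonormal ℝ fun k => ε k p) {α : VForm M End4} (hα : α.IsSmooth)
    (k l : Fin 4) (p : M) (u v : Plane) :
    VForm.d (V := ℝ) (frameForm ε α k l) p u v = inner ℝ (ε l p) (α.d p u v (ε k p)) +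
      ∑ m, (wedge (frameForm ε α k m) (frameConn ε m l) p u v +
        wedge (frameConn ε k m) (frameForm ε α m l) p u v) := by
  have hL : ContMDiff 𝓘(ℝ, Plane) 𝓘(ℝ, End4 →L[ℝ] ℝ) ∞ (fun p => evalL (ε l p) (ε k p)) :=
    (evalL.contDiff.contMDiff.comp (hε l)).clm_apply (hε k)
  -- Differentiating `⟨ε_l, S ε_k⟩` moves each frame vector by the connection forms; the minus sign
  -- comes from their skewness.
  have hdL : ∀ (w : Plane) (S : End4), vdiff (fun p => evalL (ε l p) (ε k p)) p w S =
      ∑ m, (frameConn ε k m p w * inner ℝ (ε l p) (S (ε m p)) -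
        inner ℝ (ε m p) (S (ε k p)) * frameConn ε m l p w) := by
    intro w S
    rw [vdiff_bilinear evalL (hε l) (hε k) p w, add_apply, evalL_apply, evalL_apply,
      Finset.sum_sub_distrib]
    have h1 : inner ℝ (ε l p) (S (vdiff (ε k) p w)) =
        ∑ m, frameConn ε k m p w * inner ℝ (ε l p) (S (ε m p)) := by
      conv_lhs => rw [← sum_inner_smul_eq (ho p) (vdiff (ε k) p w)]
      simp only [map_sum, map_smul, inner_sum, inner_smul_right, frameConn_apply]
    have h2 : inner ℝ (vdiff (ε l) p w) (S (ε k p)) =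
        -∑ m, inner ℝ (ε m p) (S (ε k p)) * frameConn ε m l p w := by
      conv_lhs => rw [← sum_inner_smul_eq (ho p) (S (ε k p))]
      simp only [inner_sum, inner_smul_right, frameConn_skew hε ho, mul_neg,
        Finset.sum_neg_distrib]
    rw [h1, h2]
    ring
  have h := VForm.d_clm_comp hα hL p u v
  rw [hdL, hdL] at h
  refine h.trans ?_
  rw [evalL_apply, ← Finset.sum_sub_distrib]
  congr 1
  refine Finset.sum_congr rfl fun m _ => ?_
  change _ = (frameForm ε α k m p u * frameConn ε m l p v -
    frameForm ε α k m p v * frameConn ε m l p u) + (frameConn ε k m p u * frameForm ε α m l p v -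
      frameConn ε k m p v * frameForm ε α m l p u)
  simp only [frameForm_apply]
  ring

omit [IsManifold 𝓘(ℝ, Plane) ∞ M] in
theorem IsSkew.vdiff {A : M → End4} (hA : ContMDiff 𝓘(ℝ, Plane) 𝓘(ℝ, End4) ∞ A)
    (hs : ∀ p, IsSkew (A p)) (p : M) (u : Plane) : IsSkew (vdiff A p u) := by
  intro x y
  have h1 := vdiff_clm (evalL y x + evalL x y) hA p u
  have h2 : (fun q => (evalL y x + evalL x y) (A q)) = fun _ => 0 := by
    funext q
    have := hs q x y
    rw [add_apply, evalL_apply, evalL_apply, real_inner_comm, this]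
    ring
  have h3 : InfBending.vdiff (fun _ : M => (0 : ℝ)) p u = 0 := by
    simp only [InfBending.vdiff, mfderiv_const]; rfl
  rw [h2, h3, add_apply, evalL_apply, evalL_apply, real_inner_comm] at h1
  linarith

/-- If `dT = A ∘ df`, then `dA ∧ df = 0`. -/
theorem vdiff_rotation_symm {f T : M → Space4} {A : M → End4}
    (hf : ContMDiff 𝓘(ℝ, Plane) 𝓘(ℝ, Space4) ∞ f) (hT : ContMDiff 𝓘(ℝ, Plane) 𝓘(ℝ, Space4) ∞ T)
    (hA : ContMDiff 𝓘(ℝ, Plane) 𝓘(ℝ, End4) ∞ A) (hTA : ∀ p, vdiff T p = (A p).comp (vdiff f p))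
    (p : M) (u v : Plane) : vdiff A p u (vdiff f p v) = vdiff A p v (vdiff f p u) := by
  have h1 := VForm.d_clm_comp (vdiff_isSmooth hf) hA p u v
  rw [← funext hTA, VForm.d_vdiff hT, VForm.d_vdiff hf, map_zero, zero_add] at h1
  exact sub_eq_zero.1 h1.symm

/-- The trilinear form `(u, v, w) ↦ ⟨D w, β(u) D v⟩` is symmetric in `u, v` and skew in `v, w`.
Going once round the three arguments changes its sign, so it vanishes, as in the uniqueness of the
Levi-Civita connection. With `β = dA` and `D = df` this is `φ₁₂ = 0`. -/
theorem isSkew_symm_eq_zero {β : Plane →L[ℝ] End4} (hβ : ∀ u, IsSkew (β u))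
    {D : Plane →L[ℝ] Space4} (hs : ∀ u v, β u (D v) = β v (D u)) (u v w : Plane) :
    inner ℝ (D w) (β u (D v)) = 0 := by
  have h : ∀ a b c, inner ℝ (D c) (β a (D b)) = -inner ℝ (D b) (β a (D c)) := by
    intro a b c
    have := hβ a (D b) (D c)
    rw [real_inner_comm] at this
    exact this
  have h1 := h u v w
  have h2 := h v w u
  have h3 := h w u v
  rw [hs u w] at h1
  rw [hs v u] at h2
  rw [hs w v] at h3
  linarith

variable {f : M → Space4} {e : TangentPair M} {ν : NormalPair M}

/-- The index form of the splitting of sums over tangent and normal indices. -/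
theorem sum_tIdx_add_nIdx {R : Type*} [AddCommMonoid R] (g : Fin 4 → R) :
    ∑ m, g m = ∑ j : Fin 2, g (tIdx j) + ∑ a : Fin 2, g (nIdx a) :=
  Fin.sum_univ_add (a := 2) (b := 2) g

omit [IsManifold 𝓘(ℝ, Plane) ∞ M] in
theorem eps_tIdx (j : Fin 2) (p : M) : eps f e ν (tIdx j) p = vdiff f p (e j p) := by
  simp only [eps, tIdx, Fin.append_left]; rfl

omit [IsManifold 𝓘(ℝ, Plane) ∞ M] in
theorem eps_nIdx (a : Fin 2) : eps f e ν (nIdx a) = ν a := by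
  simp only [eps, nIdx, Fin.append_right]

omit [IsManifold 𝓘(ℝ, Plane) ∞ M] in
theorem exists_sum_smul_eq {p : M} {o : Orientation ℝ (TangentSpace 𝓘(ℝ, Plane) p) (Fin 2)}
    {X : Fin 2 → TangentSpace 𝓘(ℝ, Plane) p} (h : IsPositiveBasis o X) (u : Plane) :
    ∃ a : Fin 2 → ℝ, ∑ j, a j • (show Plane from X j) = u := by
  obtain ⟨b, hb, -⟩ := h
  refine ⟨fun j => b.repr u j, ?_⟩
  have := b.sum_repr u
  simp only [hb] at this
  exact this

omit [IsManifold 𝓘(ℝ, Plane) ∞ M] in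
-- The first structure identity `df = ∑ ω_j ε_j`, which turns wedge sums with `ω_j` into statements
-- about `df`.
theorem sum_coframe_smul {o : ∀ p : M, Orientation ℝ (TangentSpace 𝓘(ℝ, Plane) p) (Fin 2)}
    {p : M} (h : IsOrthonormalFrameAt o f e ν p) (u : Plane) :
    ∑ j, coframe f e j p u • eps f e ν (tIdx j) p = vdiff f p u := by
  obtain ⟨ho, hb, -⟩ := h
  have hon : ∀ i j : Fin 2, inner ℝ (vdiff f p (e i p)) (vdiff f p (e j p)) =
      if i = j then (1 : ℝ) else 0 := by
    intro i j
    have := orthonormal_iff_ite.1 ho (tIdx i) (tIdx j)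
    rw [eps_tIdx, eps_tIdx] at this
    rw [this]
    exact if_congr (Fin.castAdd_injective 2 2).eq_iff rfl rfl
  obtain ⟨a, ha⟩ := exists_sum_smul_eq hb u
  have hfu : vdiff f p u = ∑ j, a j • vdiff f p (e j p) := by
    conv_lhs => rw [← ha]
    rw [map_sum]
    exact Finset.sum_congr rfl fun j _ => map_smul (vdiff f p) _ _
  have hc : ∀ j, coframe f e j p u = a j := by
    intro j
    rw [coframe_apply, hfu, inner_sum]
    simp [inner_smul_right, hon]
  rw [hfu]
  exact Finset.sum_congr rfl fun j _ => by rw [hc, eps_tIdx]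

omit [IsManifold 𝓘(ℝ, Plane) ∞ M] in
theorem wedge_zero_left (β : OneForm M) : wedge 0 β = 0 := by
  funext p u v; simp [wedge]

omit [IsManifold 𝓘(ℝ, Plane) ∞ M] in
theorem wedge_zero_right (α : OneForm M) : wedge α 0 = 0 := by
  funext p u v; simp [wedge]

omit [IsManifold 𝓘(ℝ, Plane) ∞ M] in
theorem wedge_neg_neg (α β : OneForm M) : wedge (-α) (-β) = wedge α β := by
  funext p u v; simp [wedge]

omit [IsManifold 𝓘(ℝ, Plane) ∞ M] in
theorem wedge_antisymm (α β : OneForm M) : wedge β α = -wedge α β := by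
  funext p u v; simp only [wedge, Pi.neg_apply]; ring

omit [IsManifold 𝓘(ℝ, Plane) ∞ M] in
theorem OneForm.eq_zero_of_skew {α : OneForm M} (h : α = -α) : α = 0 := by
  funext p
  refine ContinuousLinearMap.ext fun u => ?_
  have h1 : α p u = -α p u := congrArg (fun β : OneForm M => β p u) h
  change α p u = 0
  linarith

omit [IsManifold 𝓘(ℝ, Plane) ∞ M] in
theorem TwoForm.eq_zero_of_skew {α : TwoForm M} (h : α = -α) : α = 0 := by
  funext p u v
  have h1 : α p u v = -α p u v := congrArg (fun β : TwoForm M => β p u v) h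
  change α p u v = 0
  linarith

omit [IsManifold 𝓘(ℝ, Plane) ∞ M] in
theorem OneForm.d_neg (α : OneForm M) : (-α).d = -α.d := by
  have h : ∀ p, OneForm.inChart (-α) p = -α.inChart p := fun p => by
    funext y; exact ContinuousLinearMap.neg_comp _ _
  funext p u v
  simp only [OneForm.d, h, fderiv_neg, Pi.neg_apply, neg_apply]
  ring

omit [IsManifold 𝓘(ℝ, Plane) ∞ M] in
theorem OneForm.d_zero : (0 : OneForm M).d = 0 := by
  have := OneForm.d_neg (0 : OneForm M)
  rw [neg_zero] at this
  exact TwoForm.eq_zero_of_skew this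

/-- The right-hand side of the linearized structure equations. -/
def structureSum (φ ψ : Fin 4 → Fin 4 → OneForm M) (k l : Fin 4) : TwoForm M :=
  ∑ m, (wedge (φ k m) (ψ m l) + wedge (ψ k m) (φ m l))

omit [IsManifold 𝓘(ℝ, Plane) ∞ M] in
-- Both sides of the structure equations are skew in `(k, l)`, so it suffices to check one of each
-- pair of indices.
theorem structureSum_antisymm {φ ψ : Fin 4 → Fin 4 → OneForm M} (hφ : ∀ k l, φ k l = -φ l k)
    (hψ : ∀ k l, ψ k l = -ψ l k) (k l : Fin 4) :
    structureSum φ ψ l k = -structureSum φ ψ k l := by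
  simp only [structureSum, ← Finset.sum_neg_distrib]
  refine Finset.sum_congr rfl fun m _ => ?_
  rw [hφ l m, hψ m k, hψ l m, hφ m k, wedge_neg_neg, wedge_neg_neg, wedge_antisymm (ψ k m),
    wedge_antisymm (φ k m), neg_add_rev]

theorem connForm_skew (hε : ∀ k, ContMDiff 𝓘(ℝ, Plane) 𝓘(ℝ, Space4) ∞ (eps f e ν k))
    (ho : ∀ p, Orthonormal ℝ fun k => eps f e ν k p) (k l : Fin 4) :
    connForm f e ν k l = -connForm f e ν l k := by
  funext p
  refine ContinuousLinearMap.ext fun (u : Plane) => ?_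
  have h := frameConn_skew hε ho l k p u
  rw [real_inner_comm] at h
  exact h

/-- The fundamental system says that the tangential components vanish, that the first Bianchi type
identity holds and that the linearized structure equations hold. -/
theorem isFundamentalSolution_iff
    (hε : ∀ k, ContMDiff 𝓘(ℝ, Plane) 𝓘(ℝ, Space4) ∞ (eps f e ν k))
    (ho : ∀ p, Orthonormal ℝ fun k => eps f e ν k p) (φ : Fin 4 → Fin 4 → OneForm M) :
    IsFundamentalSolution f e ν φ ↔ (∀ k l, (φ k l).IsSmooth) ∧ (∀ k l, φ k l = -φ l k) ∧
      (∀ i j, φ (tIdx i) (tIdx j) = 0) ∧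
      (∀ a : Fin 2, ∑ j : Fin 2, wedge (coframe f e j) (φ (tIdx j) (nIdx a)) = 0) ∧
      ∀ k l, (φ k l).d = structureSum φ (connForm f e ν) k l := by
  have hω := connForm_skew hε ho
  have hω0 : ∀ k, connForm f e ν k k = 0 := fun k => OneForm.eq_zero_of_skew (hω k k)
  -- Splitting the sum over `m` into tangent and normal indices and dropping the vanishing `φ_{jr}`
  -- and diagonal terms leaves exactly the written right-hand sides of Codazzi, Gauss and Ricci.
  have key : (∀ k l, φ k l = -φ l k) → (∀ i j, φ (tIdx i) (tIdx j) = 0) →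
      (∀ j a : Fin 2, structureSum φ (connForm f e ν) (tIdx j) (nIdx a) =
        ∑ r : Fin 2, wedge (connForm f e ν (tIdx j) (tIdx r)) (φ (tIdx r) (nIdx a)) +
        ∑ b : Fin 2, (wedge (φ (tIdx j) (nIdx b)) (connForm f e ν (nIdx b) (nIdx a)) +
          wedge (connForm f e ν (tIdx j) (nIdx b)) (φ (nIdx b) (nIdx a)))) ∧
      structureSum φ (connForm f e ν) (tIdx 0) (tIdx 1) =
        ∑ a : Fin 2, (wedge (φ (tIdx 0) (nIdx a)) (connForm f e ν (nIdx a) (tIdx 1)) +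
          wedge (connForm f e ν (tIdx 0) (nIdx a)) (φ (nIdx a) (tIdx 1))) ∧
      structureSum φ (connForm f e ν) (nIdx 0) (nIdx 1) =
        ∑ j : Fin 2, (wedge (φ (nIdx 0) (tIdx j)) (connForm f e ν (tIdx j) (nIdx 1)) +
          wedge (connForm f e ν (nIdx 0) (tIdx j)) (φ (tIdx j) (nIdx 1))) := by
    intro hskew htan
    have hφ0 : ∀ k, φ k k = 0 := fun k => OneForm.eq_zero_of_skew (hskew k k)
    refine ⟨fun j a => ?_, ?_, ?_⟩
    · rw [structureSum, sum_tIdx_add_nIdx]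
      simp [htan, wedge_zero_left]
    · rw [structureSum, sum_tIdx_add_nIdx]
      simp [htan, wedge_zero_left, wedge_zero_right]
    · rw [structureSum, sum_tIdx_add_nIdx]
      simp only [Fin.sum_univ_two (f := fun a : Fin 2 => wedge (φ (nIdx 0) (nIdx a)) _ + _), hφ0,
        hω0, wedge_zero_left, wedge_zero_right, add_zero]
  constructor
  · rintro ⟨hsm, htan, hskew, hsymm, hcod, hgauss, hricci⟩
    have htan' : ∀ i j, φ (tIdx i) (tIdx j) = 0 := by
      intro i j
      fin_cases i <;> fin_cases j
      · exact OneForm.eq_zero_of_skew (hskew _ _)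
      · exact htan
      · rw [hskew]
        exact neg_eq_zero.2 htan
      · exact OneForm.eq_zero_of_skew (hskew _ _)
    obtain ⟨k1, k2, k3⟩ := key hskew htan'
    have hswap : ∀ k l, (φ k l).d = structureSum φ (connForm f e ν) k l →
        (φ l k).d = structureSum φ (connForm f e ν) l k := by
      intro k l h
      rw [hskew l k, OneForm.d_neg, h, structureSum_antisymm hskew hω k l]
    have hdiag : ∀ k, (φ k k).d = structureSum φ (connForm f e ν) k k := by
      intro k
      rw [OneForm.eq_zero_of_skew (hskew k k), OneForm.d_zero,
        TwoForm.eq_zero_of_skew (structureSum_antisymm hskew hω k k)]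
    have hta : ∀ j a, (φ (tIdx j) (nIdx a)).d =
        structureSum φ (connForm f e ν) (tIdx j) (nIdx a) := fun j a =>
      (hcod j a).trans (k1 j a).symm
    -- The Gauss equation is the structure equation of `φ₁₂`, whose left-hand side is zero.
    have htt : (φ (tIdx 0) (tIdx 1)).d = structureSum φ (connForm f e ν) (tIdx 0) (tIdx 1) := by
      rw [k2, hgauss, htan, OneForm.d_zero]
    have hnn : (φ (nIdx 0) (nIdx 1)).d = structureSum φ (connForm f e ν) (nIdx 0) (nIdx 1) :=
      hricci.trans k3.symm
    refine ⟨hsm, hskew, htan', hsymm, fun k l => ?_⟩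
    refine Fin.addCases (m := 2) (n := 2) (fun i => ?_) (fun i => ?_) k <;>
      refine Fin.addCases (m := 2) (n := 2) (fun j => ?_) (fun j => ?_) l
    · fin_cases i <;> fin_cases j
      exacts [hdiag _, htt, hswap _ _ htt, hdiag _]
    · exact hta i j
    · exact hswap _ _ (hta j i)
    · fin_cases i <;> fin_cases j
      exacts [hdiag _, hnn, hswap _ _ hnn, hdiag _]
  · rintro ⟨hsm, hskew, htan, hsymm, hd⟩
    obtain ⟨k1, k2, k3⟩ := key hskew htan
    exact ⟨hsm, htan 0 1, hskew, hsymm, fun j a => (hd _ _).trans (k1 j a), by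
      rw [← k2, ← hd, htan, OneForm.d_zero], (hd _ _).trans k3⟩

omit [IsManifold 𝓘(ℝ, Plane) ∞ M] in
-- By `df = ∑ ω_j ε_j`, the sum is minus the `ε_l`-component of `α ∧ df`; so the symmetry equations
-- control `α ∧ df`.
theorem sum_coframe_wedge_frameForm
    {o : ∀ p : M, Orientation ℝ (TangentSpace 𝓘(ℝ, Plane) p) (Fin 2)} {p : M}
    (ho : IsOrthonormalFrameAt o f e ν p) (α : VForm M End4) (l : Fin 4) (u v : Plane) :
    (∑ j : Fin 2, wedge (coframe f e j) (frameForm (eps f e ν) α (tIdx j) l)) p u v =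
      inner ℝ (eps f e ν l p) (α p v (vdiff f p u)) -
        inner ℝ (eps f e ν l p) (α p u (vdiff f p v)) := by
  have h : ∀ w x : Plane, inner ℝ (eps f e ν l p) (α p w (vdiff f p x)) =
      ∑ j, coframe f e j p x * frameForm (eps f e ν) α (tIdx j) l p w := by
    intro w x
    rw [← sum_coframe_smul ho x]
    simp only [map_sum, map_smul, inner_sum, inner_smul_right, frameForm_apply]
  rw [h, h, ← Finset.sum_sub_distrib]
  simp only [Fin.sum_univ_two]
  rfl

/-- If the differentials of a skew rotation field `A` and of a field `T` are related by
`dT = A ∘ df`, the components of `dA` solve the fundamental system. -/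
theorem isFundamentalSolution_frameForm
    {o : ∀ p : M, Orientation ℝ (TangentSpace 𝓘(ℝ, Plane) p) (Fin 2)}
    (hf : ContMDiff 𝓘(ℝ, Plane) 𝓘(ℝ, Space4) ∞ f)
    (hε : ∀ k, ContMDiff 𝓘(ℝ, Plane) 𝓘(ℝ, Space4) ∞ (eps f e ν k))
    (ho : ∀ p, IsOrthonormalFrameAt o f e ν p) {A : M → End4} {T : M → Space4}
    (hA : ContMDiff 𝓘(ℝ, Plane) 𝓘(ℝ, End4) ∞ A) (hs : ∀ p, IsSkew (A p))
    (hT : ContMDiff 𝓘(ℝ, Plane) 𝓘(ℝ, Space4) ∞ T)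
    (hTA : ∀ p, vdiff T p = (A p).comp (vdiff f p)) :
    IsFundamentalSolution f e ν (frameForm (eps f e ν) (vdiff A)) := by
  have hds := IsSkew.vdiff hA hs
  have hsymm := vdiff_rotation_symm hf hT hA hTA
  have hon : ∀ p, Orthonormal ℝ fun k => eps f e ν k p := fun p => (ho p).1
  have hskew : ∀ k l, frameForm (eps f e ν) (vdiff A) k l =
      -frameForm (eps f e ν) (vdiff A) l k := by
    intro k l
    funext p
    refine ContinuousLinearMap.ext fun (u : Plane) => ?_
    change frameForm (eps f e ν) (vdiff A) k l p u = -frameForm (eps f e ν) (vdiff A) l k p u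
    rw [frameForm_apply, frameForm_apply, real_inner_comm, hds p u]
  have htan : ∀ i j, frameForm (eps f e ν) (vdiff A) (tIdx i) (tIdx j) = 0 := by
    intro i j
    funext p
    refine ContinuousLinearMap.ext fun (u : Plane) => ?_
    change frameForm (eps f e ν) (vdiff A) _ _ p u = 0
    rw [frameForm_apply, eps_tIdx, eps_tIdx]
    exact isSkew_symm_eq_zero (hds p) (hsymm p) u _ _
  have hd : ∀ k l, (frameForm (eps f e ν) (vdiff A) k l).d =
      structureSum (frameForm (eps f e ν) (vdiff A)) (connForm f e ν) k l := by
    intro k l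
    funext p u v
    rw [OneForm.d_eq]
    refine (d_frameForm hε hon (vdiff_isSmooth hA) k l p u v).trans ?_
    -- Since `d(dA) = 0`, only the connection terms of the general formula survive, and these are
    -- the structure sum.
    erw [VForm.d_vdiff hA]
    simp only [structureSum, Fin.sum_univ_four]
    simp [connForm_eq]
  refine (isFundamentalSolution_iff hε hon _).2 ⟨fun k l => frameForm_isSmooth hε
    (vdiff_isSmooth hA) k l, hskew, htan, fun a => ?_, hd⟩
  funext p u v
  refine (sum_coframe_wedge_frameForm (ho p) (vdiff A) (nIdx a) u v).trans ?_
  rw [hsymm p u v]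
  exact sub_self _

/-- `(x, y) ↦ (z ↦ ⟨x, z⟩ y)`. -/
def rankOneL : Space4 →L[ℝ] Space4 →L[ℝ] End4 :=
  (ContinuousLinearMap.smulRightL ℝ Space4 Space4).comp innerL

/-- The endomorphism-valued 1-form with given components with respect to a frame. -/
def frameCombination (ε : Fin 4 → M → Space4) (φ : Fin 4 → Fin 4 → OneForm M) : VForm M End4 :=
  fun p => ∑ k, ∑ l, (ContinuousLinearMap.smulRightL ℝ ℝ End4 (ContinuousLinearMap.id ℝ ℝ)
    (rankOneL (ε k p) (ε l p))).comp (φ k l p : Plane →L[ℝ] ℝ)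

theorem frameCombination_isSmooth (hε : ∀ k, ContMDiff 𝓘(ℝ, Plane) 𝓘(ℝ, Space4) ∞ (ε k))
    {φ : Fin 4 → Fin 4 → OneForm M} (hφ : ∀ k l, (φ k l).IsSmooth) :
    (frameCombination ε φ).IsSmooth :=
  VForm.IsSmooth.sum fun k _ => VForm.IsSmooth.sum fun l _ =>
    VForm.IsSmooth.clm_comp (V := ℝ) (hφ k l)
      ((ContinuousLinearMap.smulRightL ℝ ℝ End4 (ContinuousLinearMap.id ℝ ℝ)).contDiff.contMDiff.comp
        ((rankOneL.contDiff.contMDiff.comp (hε k)).clm_apply (hε l)))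

omit [IsManifold 𝓘(ℝ, Plane) ∞ M] in
theorem frameForm_frameCombination (ho : ∀ p, Orthonormal ℝ fun k => ε k p)
    (φ : Fin 4 → Fin 4 → OneForm M) (k l : Fin 4) :
    frameForm ε (frameCombination ε φ) k l = φ k l := by
  funext p
  refine ContinuousLinearMap.ext fun (u : Plane) => ?_
  have h : ∀ i j, inner ℝ (ε i p) (ε j p) = if i = j then (1 : ℝ) else 0 :=
    orthonormal_iff_ite.1 (ho p)
  refine (frameForm_apply ε _ k l p u).trans ?_
  have h2 : frameCombination ε φ p u (ε k p) =
      ∑ i, ∑ j, φ i j p u • (inner ℝ (ε i p) (ε k p) • ε j p) := by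
    simp only [frameCombination, sum_apply]
    rfl
  rw [h2]
  simp [inner_sum, inner_smul_right, h]

theorem End4.ext_frame {v : Fin 4 → Space4} (hv : Orthonormal ℝ v) {S S' : End4}
    (h : ∀ k l, inner ℝ (v l) (S (v k)) = inner ℝ (v l) (S' (v k))) : S = S' := by
  have h1 : ∀ k, S (v k) = S' (v k) := fun k => by
    rw [← sum_inner_smul_eq hv (S (v k)), ← sum_inner_smul_eq hv (S' (v k))]
    simp only [h]
  ext1 x
  rw [← sum_inner_smul_eq hv x]
  simp only [map_sum, map_smul, h1]

theorem isSkew_of_frame {v : Fin 4 → Space4} (hv : Orthonormal ℝ v) {S : End4}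
    (h : ∀ k l, inner ℝ (S (v k)) (v l) = -inner ℝ (v k) (S (v l))) : IsSkew S := by
  intro x y
  rw [← sum_inner_smul_eq hv x, ← sum_inner_smul_eq hv y]
  simp only [map_sum, map_smul, inner_sum, sum_inner, inner_smul_right, inner_smul_left, h,
    mul_neg, Finset.sum_neg_distrib]

/-- The endomorphism-valued 1-form with the components `φ`, for a solution `φ` of the fundamental
system. -/
theorem frameCombination_spec
    {o : ∀ p : M, Orientation ℝ (TangentSpace 𝓘(ℝ, Plane) p) (Fin 2)}
    (hε : ∀ k, ContMDiff 𝓘(ℝ, Plane) 𝓘(ℝ, Space4) ∞ (eps f e ν k))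
    (ho : ∀ p, IsOrthonormalFrameAt o f e ν p) {φ : Fin 4 → Fin 4 → OneForm M}
    (hφ : IsFundamentalSolution f e ν φ) :
    (∀ p u v, (frameCombination (eps f e ν) φ).d p u v = 0) ∧
    (∀ p u, IsSkew (frameCombination (eps f e ν) φ p u)) ∧
    ∀ p u v, frameCombination (eps f e ν) φ p u (vdiff f p v) =
      frameCombination (eps f e ν) φ p v (vdiff f p u) := by
  have hon : ∀ p, Orthonormal ℝ fun k => eps f e ν k p := fun p => (ho p).1
  obtain ⟨hsm, hskew, htan, hsymm, hd⟩ := (isFundamentalSolution_iff hε hon φ).1 hφ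
  set B := frameCombination (eps f e ν) φ with hB
  have hBφ : frameForm (eps f e ν) B = φ := by
    funext k l
    exact frameForm_frameCombination hon φ k l
  refine ⟨fun p u v => ?_, fun p u => ?_, fun p u v => ?_⟩
  · refine End4.ext_frame (hon p) fun k l => ?_
    have h1 := d_frameForm hε hon (frameCombination_isSmooth hε hsm) k l p u v
    rw [← hB, hBφ] at h1
    have h2 : VForm.d (V := ℝ) (φ k l) p u v = structureSum φ (connForm f e ν) k l p u v := by
      rw [← OneForm.d_eq, hd]
    have h3 : structureSum φ (connForm f e ν) k l p u v =
        ∑ m, (wedge (φ k m) (frameConn (eps f e ν) m l) p u v +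
          wedge (frameConn (eps f e ν) k m) (φ m l) p u v) := by
      simp only [structureSum, Fin.sum_univ_four]
      rfl
    rw [h2, h3] at h1
    -- The structure equations and the general formula for `d` of a component have the same
    -- connection terms; what is left over is the component of `dB`.
    have h4 := left_eq_add.1 (h1.trans (add_comm _ _))
    rw [h4]
    simp
  · refine isSkew_of_frame (hon p) fun k l => ?_
    have h1 : ∀ k l, inner ℝ (eps f e ν l p) (B p u (eps f e ν k p)) = φ k l p u := fun k l => by
      rw [← hBφ]; rfl
    rw [real_inner_comm, h1, h1, hskew k l]
    rfl
  · rw [← sum_inner_smul_eq (hon p) (B p u (vdiff f p v)),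
      ← sum_inner_smul_eq (hon p) (B p v (vdiff f p u))]
    refine Finset.sum_congr rfl fun l _ => ?_
    congr 1
    have h1 := sum_coframe_wedge_frameForm (ho p) B l u v
    rw [hBφ] at h1
    -- For normal `l` this is the symmetry equation; for tangent `l` every `φ_{jl}` already
    -- vanishes. Hence all four components of `B ∧ df` are zero.
    have h2 : ∑ j : Fin 2, wedge (coframe f e j) (φ (tIdx j) l) = 0 := by
      refine Fin.addCases (m := 2) (n := 2) (fun i => ?_) (fun a => ?_) l
      · exact Finset.sum_eq_zero fun j _ => by
          rw [show Fin.castAdd 2 i = tIdx i from rfl, htan, wedge_zero_right]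
      · exact hsymm a
    rw [h2] at h1
    exact (sub_eq_zero.1 h1.symm).symm

end Frame

/-! ### The infinitesimal rotation of an adapted frame. -/

section Rotation

variable {M : Type*} [TopologicalSpace M] [ChartedSpace Plane M] [IsManifold 𝓘(ℝ, Plane) ∞ M]
variable {o : ∀ p : M, Orientation ℝ (TangentSpace 𝓘(ℝ, Plane) p) (Fin 2)}
  {D : Set (ℝ × M)} {F : ℝ → M → Space4} {e : ℝ → TangentPair M} {ν : ℝ → NormalPair M}

theorem contMDiffOn_eps (hD : IsOpen D)
    (hF : ContMDiffOn (𝓘(ℝ, ℝ).prod 𝓘(ℝ, Plane)) 𝓘(ℝ, Space4) ∞ (fun q : ℝ × M => F q.1 q.2) D)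
    (he : ∀ j, ContMDiffOn (𝓘(ℝ, ℝ).prod 𝓘(ℝ, Plane)) 𝓘(ℝ, Plane).tangent ∞
      (fun q : ℝ × M => (⟨q.2, e q.1 j q.2⟩ : TangentBundle 𝓘(ℝ, Plane) M)) D)
    (hν : ∀ a, ContMDiffOn (𝓘(ℝ, ℝ).prod 𝓘(ℝ, Plane)) 𝓘(ℝ, Space4) ∞
      (fun q : ℝ × M => ν q.1 a q.2) D) (k : Fin 4) :
    ContMDiffOn (𝓘(ℝ, ℝ).prod 𝓘(ℝ, Plane)) 𝓘(ℝ, Space4) ∞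
      (fun q : ℝ × M => eps (F q.1) (e q.1) (ν q.1) k q.2) D := by
  refine Fin.addCases (m := 2) (n := 2) (fun j => ?_) (fun a => ?_) k
  · refine (contMDiffOn_vdiff_family (X := fun t => e t j) hD hF (he j)).congr fun q _ => ?_
    exact eps_tIdx j q.2
  · refine (hν a).congr fun q _ => ?_
    exact congrFun (eps_nIdx a) q.2

omit [IsManifold 𝓘(ℝ, Plane) ∞ M] in
theorem contMDiff_slice {V : Type*} [NormedAddCommGroup V] [NormedSpace ℝ V] {G : ℝ → M → V}
    (hD₀ : ∀ p, ((0 : ℝ), p) ∈ D)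
    (hG : ContMDiffOn (𝓘(ℝ, ℝ).prod 𝓘(ℝ, Plane)) 𝓘(ℝ, V) ∞ (fun q : ℝ × M => G q.1 q.2) D) :
    ContMDiff 𝓘(ℝ, Plane) 𝓘(ℝ, V) ∞ (G 0) :=
  hG.comp_contMDiff (contMDiff_const.prodMk contMDiff_id) hD₀

omit [ChartedSpace Plane M] [IsManifold 𝓘(ℝ, Plane) ∞ M] in
theorem eventually_mem_slice (hD : IsOpen D) {p : M} (h : ((0 : ℝ), p) ∈ D) :
    ∀ᶠ t : ℝ in nhds 0, (t, p) ∈ D :=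
  (Continuous.continuousAt (by fun_prop : Continuous fun t : ℝ => (t, p))).eventually
    (hD.mem_nhds h)

omit [IsManifold 𝓘(ℝ, Plane) ∞ M] in
theorem clm_eq_of_frame {f : M → Space4} {e : TangentPair M} {ν : NormalPair M} {p : M}
    (h : IsOrthonormalFrameAt o f e ν p) {L L' : Plane →L[ℝ] Space4}
    (hL : ∀ j, L (e j p) = L' (e j p)) : L = L' := by
  ext1 u
  obtain ⟨a, rfl⟩ := exists_sum_smul_eq h.2.1 u
  rw [map_sum, map_sum]
  refine Finset.sum_congr rfl fun j _ => ?_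
  rw [map_smul, map_smul]
  exact congrArg _ (hL j)

/-- The motion of an adapted frame is infinitesimally given by a smooth field `A` of skew
endomorphisms, and `A` determines the variations of the differential and of the connection
forms. -/
theorem exists_rotation (hD : IsOpen D) (hD₀ : ∀ p, ((0 : ℝ), p) ∈ D)
    (hF : ContMDiffOn (𝓘(ℝ, ℝ).prod 𝓘(ℝ, Plane)) 𝓘(ℝ, Space4) ∞ (fun q : ℝ × M => F q.1 q.2) D)
    (h : IsAdaptedFrame o D F e ν) :
    ∃ A : M → End4, ContMDiff 𝓘(ℝ, Plane) 𝓘(ℝ, End4) ∞ A ∧ (∀ p, IsSkew (A p)) ∧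
      (∀ p, vdiff (variation F) p = (A p).comp (vdiff (F 0) p)) ∧
      (∀ k p, HasDerivAt (fun t => eps (F t) (e t) (ν t) k p)
        (A p (eps (F 0) (e 0) (ν 0) k p)) 0) ∧
      (∀ j p, HasVariationAt (fun t => coframe (F t) (e t) j) 0 p) ∧
      ∀ k l p, HasVariationAt (fun t => connForm (F t) (e t) (ν t) k l)
        (frameForm (eps (F 0) (e 0) (ν 0)) (vdiff A) k l) p := by
  obtain ⟨he, hν, hframe, he₀⟩ := h
  set ε : ℝ → Fin 4 → M → Space4 := fun t => eps (F t) (e t) (ν t) with hεdef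
  have hε : ∀ k, ContMDiffOn (𝓘(ℝ, ℝ).prod 𝓘(ℝ, Plane)) 𝓘(ℝ, Space4) ∞
      (fun q : ℝ × M => ε q.1 k q.2) D := contMDiffOn_eps hD hF he hν
  have hε0 : ∀ k, ContMDiff 𝓘(ℝ, Plane) 𝓘(ℝ, Space4) ∞ (ε 0 k) := fun k =>
    contMDiff_slice (G := fun t => ε t k) hD₀ (hε k)
  set η : Fin 4 → M → Space4 := fun k => variation (fun t => ε t k)
  have hη : ∀ k, ContMDiff 𝓘(ℝ, Plane) 𝓘(ℝ, Space4) ∞ (η k) := fun k =>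
    contMDiff_variation (F := fun t => ε t k) hD hD₀ (hε k)
  have hεη : ∀ k p, HasDerivAt (fun t => ε t k p) (η k p) 0 := fun k p =>
    hasDerivAt_variation (F := fun t => ε t k) hD (hε k) (hD₀ p)
  have hon : ∀ p, Orthonormal ℝ fun k => ε 0 k p := fun p => (hframe 0 p (hD₀ p)).1
  -- The endomorphism taking each frame vector to its velocity.
  set A : M → End4 := fun p => ∑ k, rankOneL (ε 0 k p) (η k p) with hA
  have hAs : ContMDiff 𝓘(ℝ, Plane) 𝓘(ℝ, End4) ∞ A := by
    refine contMDiff_finsetSum fun k _ => ?_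
    exact (rankOneL.contDiff.contMDiff.comp (hε0 k)).clm_apply (hη k)
  have hAε : ∀ k p, A p (ε 0 k p) = η k p := by
    intro k p
    have h1 : A p (ε 0 k p) = ∑ m, inner ℝ (ε 0 m p) (ε 0 k p) • η m p := by
      simp only [hA, sum_apply]
      rfl
    rw [h1]
    simp [orthonormal_iff_ite.1 (hon p)]
  have hskew : ∀ p, IsSkew (A p) := by
    intro p
    refine isSkew_of_frame (hon p) fun k l => ?_
    have h1 := (hεη k p).inner ℝ (hεη l p)
    have h2 : HasDerivAt (fun t => inner ℝ (ε t k p) (ε t l p)) (0 : ℝ) 0 := by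
      refine (hasDerivAt_const (0 : ℝ) (if k = l then (1 : ℝ) else 0)).congr_of_eventuallyEq ?_
      filter_upwards [eventually_mem_slice hD (hD₀ p)] with t ht
      exact orthonormal_iff_ite.1 (hframe t p ht).1 k l
    have h3 := h1.unique h2
    rw [hAε, hAε]
    linarith
  have hT : ∀ p, vdiff (variation F) p = (A p).comp (vdiff (F 0) p) := by
    intro p
    refine clm_eq_of_frame (hframe 0 p (hD₀ p)) fun j => ?_
    -- The velocity of `df_t(e_j(t))` is `dT(e_j) + df(δe_j)`, and adaptedness kills the second
    -- term.
    have h1 : HasDerivAt (fun t => ε t (tIdx j) p)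
        (vdiff (variation F) p (e 0 j p) + vdiff (F 0) p (0 : Plane)) 0 := by
      have h2 : HasDerivAt (fun t => (e t j p : Plane)) (0 : Plane) 0 := he₀ p (hD₀ p) j
      refine ((hasDerivAt_vdiff hD hD₀ hF p).clm_apply h2).congr_of_eventuallyEq ?_
      exact Filter.Eventually.of_forall fun t => eps_tIdx j p
    have h3 := (hεη (tIdx j) p).unique h1
    rw [map_zero, add_zero] at h3
    rw [← h3, ← hAε]
    exact congrArg (A p) (eps_tIdx j p)
  refine ⟨A, hAs, hskew, hT, fun k p => ?_, fun j p (X : Plane) => ?_, fun k l p (X : Plane) => ?_⟩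
  · rw [hAε]
    exact hεη k p
  · have h1 : HasDerivAt (fun t => vdiff (F t) p X) (vdiff (variation F) p X) 0 := by
      simpa using (hasDerivAt_vdiff hD hD₀ hF p).clm_apply (hasDerivAt_const (0 : ℝ) X)
    have h2 := (hεη (tIdx j) p).inner ℝ h1
    -- The sum is `⟨ε_j, A df X⟩ + ⟨A ε_j, df X⟩`, zero by skewness: this is `δω_j = 0`.
    have h3 : inner ℝ (ε 0 (tIdx j) p) (vdiff (variation F) p X) +
        inner ℝ (η (tIdx j) p) (vdiff (F 0) p X) = 0 := by
      rw [hT, ← hAε, hskew p, ContinuousLinearMap.comp_apply, add_neg_cancel]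
    rw [h3] at h2
    refine h2.congr_of_eventuallyEq (Filter.Eventually.of_forall fun t => ?_)
    refine (coframe_apply (F t) (e t) j p X).trans ?_
    change _ = inner ℝ (ε t (tIdx j) p) (vdiff (F t) p X)
    rw [← eps_tIdx (ν := ν t)]
  · have h1 : HasDerivAt (fun t => vdiff (ε t k) p X) (vdiff (η k) p X) 0 := by
      simpa using (hasDerivAt_vdiff (F := fun t => ε t k) hD hD₀ (hε k) p).clm_apply
        (hasDerivAt_const (0 : ℝ) X)
    have h2 := (hεη l p).inner ℝ h1
    have h3 : vdiff (η k) p X = vdiff A p X (ε 0 k p) + A p (vdiff (ε 0 k) p X) := by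
      have h4 := vdiff_bilinear (ContinuousLinearMap.id ℝ End4) hAs (hε0 k) p X
      have h5 : (fun q => (ContinuousLinearMap.id ℝ End4) (A q) (ε 0 k q)) = η k :=
        funext fun q => hAε k q
      rw [h5] at h4
      exact h4
    -- With `d(A ε_k) = dA ε_k + A dε_k`, the terms containing `A` undifferentiated cancel by
    -- skewness.
    have h6 : inner ℝ (ε 0 l p) (vdiff (η k) p X) + inner ℝ (η l p) (vdiff (ε 0 k) p X) =
        inner ℝ (ε 0 l p) (vdiff A p X (ε 0 k p)) := by
      rw [h3, ← hAε l, hskew p, inner_add_right]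
      ring
    rw [h6] at h2
    exact h2

end Rotation

/-! ### Orientation along paths of bases. -/

section Orientation

variable {ι V : Type*} [Fintype ι] [DecidableEq ι] [NormedAddCommGroup V] [NormedSpace ℝ V]
  [FiniteDimensional ℝ V]

/-- A continuous path of bases stays in its orientation. -/
theorem isPositiveBasis_of_path {o : Orientation ℝ V ι} {v : ℝ → ι → V}
    (hc : ∀ i, Continuous fun t => v t i) (hv : ∀ t, LinearIndependent ℝ (v t))
    (h₀ : IsPositiveBasis o (v 0)) (t : ℝ) : IsPositiveBasis o (v t) := by
  obtain ⟨b, hb, hbo⟩ := h₀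
  have hcard : Fintype.card ι = Module.finrank ℝ V := (Module.finrank_eq_card_basis b).symm
  have hspan : ∀ s, ⊤ ≤ Submodule.span ℝ (range (v s)) := fun s =>
    ((hv s).span_eq_top_of_card_eq_finrank' hcard).ge
  set B : ∀ s, Module.Basis ι ℝ V := fun s => Module.Basis.mk (hv s) (hspan s)
  have hdetc : Continuous fun s => b.det (v s) := by
    simp only [Module.Basis.det_apply]
    refine Continuous.matrix_det (continuous_matrix fun i j => ?_)
    exact (LinearMap.continuous_of_finiteDimensional (b.coord i)).comp (hc j)
  have hne : ∀ s, b.det (v s) ≠ 0 := fun s =>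
    (b.isUnit_det (B s)).ne_zero ∘ fun h => by
      rw [← h]
      congr 1
      funext i
      exact Module.Basis.mk_apply _ _ i
  have h0 : b.det (v 0) = 1 := by
    rw [← funext hb]
    exact b.det_self
  -- The determinant relative to the initial basis starts at 1 and never vanishes, so it keeps its
  -- sign.
  have hpos : 0 < b.det (v t) := by
    by_contra hlt
    have hmem : (0 : ℝ) ∈ uIcc (b.det (v 0)) (b.det (v t)) := by
      rw [h0]
      exact mem_uIcc.2 (Or.inr ⟨not_lt.1 hlt, zero_le_one⟩)
    obtain ⟨s, -, hs⟩ := intermediate_value_uIcc hdetc.continuousOn hmem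
    exact hne s hs
  refine ⟨B t, fun i => Module.Basis.mk_apply _ _ i, ?_⟩
  rw [← hbo]
  refine ((b.orientation_eq_iff_det_pos (B t)).2 ?_).symm
  have hBv : ⇑(B t) = v t := funext fun i => Module.Basis.mk_apply _ _ i
  rw [hBv]
  exact hpos

end Orientation

/-! ### Gram-Schmidt in smooth families and to first order. -/

section GramSchmidt

open InnerProductSpace

theorem contMDiff_gramSchmidt {H E N : Type*} [NormedAddCommGroup E] [NormedSpace ℝ E]
    [TopologicalSpace H] {I : ModelWithCorners ℝ E H} [TopologicalSpace N] [ChartedSpace H N]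
    {v : N → Fin 4 → Space4} (hv : ∀ k, ContMDiff I 𝓘(ℝ, Space4) ∞ fun x => v x k)
    (hli : ∀ x, LinearIndependent ℝ (v x)) (k : Fin 4) :
    ContMDiff I 𝓘(ℝ, Space4) ∞ fun x => gramSchmidt ℝ (v x) k := by
  induction k using WellFoundedLT.induction with
  | ind k ih =>
    simp only [gramSchmidt_def ℝ _ k, Submodule.starProjection_singleton]
    refine (hv k).sub (contMDiff_finsetSum fun i hi => ?_)
    have hi' := ih i (Finset.mem_Iio.1 hi)
    have h1 : ContMDiff I 𝓘(ℝ, ℝ) ∞ fun x => inner ℝ (gramSchmidt ℝ (v x) i) (v x k) :=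
      (innerL.contDiff.contMDiff.comp hi').clm_apply (hv k)
    have h2 : ContMDiff I 𝓘(ℝ, ℝ) ∞ fun x => ‖gramSchmidt ℝ (v x) i‖ ^ 2 :=
      (contDiff_norm_sq ℝ).contMDiff.comp hi'
    exact (h1.div₀ h2 fun x => by
      have := gramSchmidt_ne_zero i (hli x)
      positivity).smul hi'

theorem contMDiff_norm_gramSchmidt_inv {H E N : Type*} [NormedAddCommGroup E] [NormedSpace ℝ E]
    [TopologicalSpace H] {I : ModelWithCorners ℝ E H} [TopologicalSpace N] [ChartedSpace H N]
    {v : N → Fin 4 → Space4} (hv : ∀ k, ContMDiff I 𝓘(ℝ, Space4) ∞ fun x => v x k)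
    (hli : ∀ x, LinearIndependent ℝ (v x)) (k : Fin 4) :
    ContMDiff I 𝓘(ℝ, ℝ) ∞ fun x => ‖gramSchmidt ℝ (v x) k‖⁻¹ := by
  intro x
  have hx := gramSchmidt_ne_zero k (hli x)
  have h1 : ContMDiffAt 𝓘(ℝ, Space4) 𝓘(ℝ, ℝ) ∞ (fun y : Space4 => ‖y‖⁻¹)
      (gramSchmidt ℝ (v x) k) :=
    ((contDiffAt_norm ℝ hx).inv (norm_ne_zero_iff.2 hx)).contMDiffAt
  exact ContMDiffAt.comp (g := fun y : Space4 => ‖y‖⁻¹) x h1 (contMDiff_gramSchmidt hv hli k x)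

variable {v : ℝ → Fin 4 → Space4} {v' : Fin 4 → Space4}

theorem hasDerivAt_inner_of_skew (hv : ∀ k, HasDerivAt (fun t => v t k) (v' k) 0)
    (hs : ∀ k l, inner ℝ (v 0 k) (v' l) + inner ℝ (v' k) (v 0 l) = 0) (k l : Fin 4) :
    HasDerivAt (fun t => inner ℝ (v t k) (v t l)) 0 0 := by
  have := (hv k).inner ℝ (hv l)
  rwa [hs k l] at this

/-- To first order, a family which stays orthonormal to first order is not changed by the
Gram-Schmidt process. -/
theorem hasDerivAt_gramSchmidt (hv : ∀ k, HasDerivAt (fun t => v t k) (v' k) 0)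
    (ho : Orthonormal ℝ (v 0))
    (hs : ∀ k l, inner ℝ (v 0 k) (v' l) + inner ℝ (v' k) (v 0 l) = 0) (k : Fin 4) :
    gramSchmidt ℝ (v 0) k = v 0 k ∧ HasDerivAt (fun t => gramSchmidt ℝ (v t) k) (v' k) 0 := by
  have h0 : ∀ k, gramSchmidt ℝ (v 0) k = v 0 k := fun k =>
    congrFun (gramSchmidt_of_orthogonal ℝ fun i j hij => ho.2 hij) k
  refine ⟨h0 k, ?_⟩
  induction k using WellFoundedLT.induction with
  | ind k ih =>
    simp only [gramSchmidt_def ℝ _ k, Submodule.starProjection_singleton]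
    -- Each projection coefficient is zero at `t = 0` by orthogonality, and so is its derivative by
    -- `hs`; hence the correction term has zero derivative.
    have key : ∀ i ∈ Finset.Iio k, HasDerivAt (fun t =>
        (inner ℝ (gramSchmidt ℝ (v t) i) (v t k) / ((‖gramSchmidt ℝ (v t) i‖ ^ 2 : ℝ) : ℝ)) •
          gramSchmidt ℝ (v t) i) 0 0 := by
      intro i hi
      have hi' := ih i (Finset.mem_Iio.1 hi)
      have h1 := hi'.inner ℝ (hv k)
      have h2 := hi'.norm_sq
      have hik : inner ℝ (v 0 i) (v 0 k) = (0 : ℝ) := ho.2 (Finset.mem_Iio.1 hi).ne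
      have h3 := (h1.div h2 (by rw [h0, ho.1 i]; norm_num)).smul hi'
      refine h3.congr_deriv ?_
      simp [h0, hs i k, hik]
    have h4 := (hv k).sub (HasDerivAt.fun_sum key)
    exact h4.congr_deriv (by simp)

theorem hasDerivAt_norm_gramSchmidt_inv (hv : ∀ k, HasDerivAt (fun t => v t k) (v' k) 0)
    (ho : Orthonormal ℝ (v 0))
    (hs : ∀ k l, inner ℝ (v 0 k) (v' l) + inner ℝ (v' k) (v 0 l) = 0) (k : Fin 4) :
    HasDerivAt (fun t => ‖gramSchmidt ℝ (v t) k‖⁻¹) 0 0 := by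
  obtain ⟨h0, h1⟩ := hasDerivAt_gramSchmidt hv ho hs k
  have h2 := h1.norm_sq
  have h3 : inner ℝ (v 0 k) (v' k) = (0 : ℝ) := by
    have := hs k k
    rw [real_inner_comm (v 0 k) (v' k)] at this
    linarith
  rw [h0, h3, mul_zero] at h2
  have h4 := (h2.sqrt (by rw [h0, ho.1 k]; norm_num)).inv (by
    rw [h0, ho.1 k]; norm_num)
  refine (h4.congr_deriv (by simp)).congr_of_eventuallyEq (Filter.Eventually.of_forall fun t => ?_)
  simp [Real.sqrt_sq]

end GramSchmidt

/-! ### Smooth combinations of tangent vector fields. -/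

section Sections

variable {M : Type*} [TopologicalSpace M] [ChartedSpace Plane M] [IsManifold 𝓘(ℝ, Plane) ∞ M]

theorem contMDiff_smul_add_smul {X Y : ∀ q : ℝ × M, TangentSpace 𝓘(ℝ, Plane) q.2}
    {a b : ℝ × M → ℝ}
    (hX : ContMDiff (𝓘(ℝ, ℝ).prod 𝓘(ℝ, Plane)) 𝓘(ℝ, Plane).tangent ∞
      (fun q : ℝ × M => (⟨q.2, X q⟩ : TangentBundle 𝓘(ℝ, Plane) M)))
    (hY : ContMDiff (𝓘(ℝ, ℝ).prod 𝓘(ℝ, Plane)) 𝓘(ℝ, Plane).tangent ∞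
      (fun q : ℝ × M => (⟨q.2, Y q⟩ : TangentBundle 𝓘(ℝ, Plane) M)))
    (ha : ContMDiff (𝓘(ℝ, ℝ).prod 𝓘(ℝ, Plane)) 𝓘(ℝ, ℝ) ∞ a)
    (hb : ContMDiff (𝓘(ℝ, ℝ).prod 𝓘(ℝ, Plane)) 𝓘(ℝ, ℝ) ∞ b) :
    ContMDiff (𝓘(ℝ, ℝ).prod 𝓘(ℝ, Plane)) 𝓘(ℝ, Plane).tangent ∞
      (fun q : ℝ × M => (⟨q.2, a q • X q + b q • Y q⟩ : TangentBundle 𝓘(ℝ, Plane) M)) := by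
  have : IsManifold 𝓘(ℝ, Plane) 1 M := IsManifold.of_le (n := ∞) (by simp)
  intro q₀
  have hX₀ := (Bundle.contMDiffAt_totalSpace.1 (hX q₀)).2
  have hY₀ := (Bundle.contMDiffAt_totalSpace.1 (hY q₀)).2
  refine Bundle.contMDiffAt_totalSpace.2 ⟨contMDiffAt_snd, ?_⟩
  refine (((ha q₀).smul hX₀).add ((hb q₀).smul hY₀)).congr_of_eventuallyEq ?_
  set E := trivializationAt Plane (TangentSpace 𝓘(ℝ, Plane) : M → Type _) q₀.2
  have hE : ∀ᶠ q : ℝ × M in nhds q₀, q.2 ∈ E.baseSet :=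
    continuousAt_snd.eventually (E.open_baseSet.mem_nhds
      (FiberBundle.mem_baseSet_trivializationAt Plane _ q₀.2))
  filter_upwards [hE] with q hq
  have hlin := E.linear ℝ hq
  change (E ⟨q.2, a q • X q + b q • Y q⟩).2 = a q • (E ⟨q.2, X q⟩).2 + b q • (E ⟨q.2, Y q⟩).2
  rw [hlin.map_add, hlin.map_smul, hlin.map_smul]

end Sections

/-! ### Extending a frame of `f` along `f + tT`. -/

section Extension

open InnerProductSpace

/-- For skew `S` one has `⟨x + tSx, x⟩ = |x|²`, so `1 + tS` is injective for every `t`. The frame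
can therefore be extended to all of ℝ × M without shrinking the domain. -/
theorem linearIndependent_add_smul {S : End4} (hS : IsSkew S) {w : Fin 4 → Space4}
    (hw : Orthonormal ℝ w) (t : ℝ) : LinearIndependent ℝ fun k => w k + t • S (w k) := by
  refine Fintype.linearIndependent_iff.2 fun g hg => ?_
  set x := ∑ k, g k • w k with hx
  have hx' : x + t • S x = 0 := by
    rw [← hg, hx]
    simp only [map_sum, map_smul, smul_add, Finset.sum_add_distrib, Finset.smul_sum, smul_comm t]
  have h0 : inner ℝ (S x) x = (0 : ℝ) := by
    have := hS x x
    rw [real_inner_comm] at this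
    rw [real_inner_comm]
    linarith
  have h1 : inner ℝ (x + t • S x) x = (0 : ℝ) := by rw [hx', inner_zero_left]
  rw [inner_add_left, real_inner_smul_left, h0, mul_zero, add_zero] at h1
  exact Fintype.linearIndependent_iff.1 hw.linearIndependent g (inner_self_eq_zero.1 h1)

theorem hasDerivAt_smul_add_smul {V : Type*} [NormedAddCommGroup V] [NormedSpace ℝ V]
    {a b : ℝ → ℝ} (ha : HasDerivAt a 0 0) (hb : HasDerivAt b 0 0) (X Y : V) :
    HasDerivAt (fun t => a t • X + b t • Y) 0 0 :=
  ((ha.smul_const X).add (hb.smul_const Y)).congr_deriv (by simp)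

variable {M : Type*} [TopologicalSpace M] [ChartedSpace Plane M] [IsManifold 𝓘(ℝ, Plane) ∞ M]
variable {o : ∀ p : M, Orientation ℝ (TangentSpace 𝓘(ℝ, Plane) p) (Fin 2)}
  {f T : M → Space4} {e : TangentPair M} {ν : NormalPair M}

omit [ChartedSpace Plane M] [IsManifold 𝓘(ℝ, Plane) ∞ M] [TopologicalSpace M] in
theorem linearDeformation_zero (f T : M → Space4) : linearDeformation f T 0 = f := by
  funext p
  simp [linearDeformation]

omit [ChartedSpace Plane M] [IsManifold 𝓘(ℝ, Plane) ∞ M] [TopologicalSpace M] in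
theorem variation_linearDeformation (f T : M → Space4) :
    variation (linearDeformation f T) = T := by
  funext p
  have h : HasDerivAt (fun t : ℝ => f p + t • T p) ((1 : ℝ) • T p) 0 :=
    ((hasDerivAt_id (0 : ℝ)).smul_const (T p)).const_add (f p)
  rw [one_smul] at h
  exact h.deriv

omit [IsManifold 𝓘(ℝ, Plane) ∞ M] in
theorem vdiff_linearDeformation (hf : ContMDiff 𝓘(ℝ, Plane) 𝓘(ℝ, Space4) ∞ f)
    (hT : ContMDiff 𝓘(ℝ, Plane) 𝓘(ℝ, Space4) ∞ T) (t : ℝ) (p : M) :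
    vdiff (linearDeformation f T t) p = vdiff f p + t • vdiff T p := by
  have h1 := (hf.mdifferentiable (by simp) p).hasMFDerivAt
  have h2 := (hT.mdifferentiable (by simp) p).hasMFDerivAt
  exact (h1.add (h2.const_smul t)).mfderiv

omit [IsManifold 𝓘(ℝ, Plane) ∞ M] in
theorem contMDiff_linearDeformation (hf : ContMDiff 𝓘(ℝ, Plane) 𝓘(ℝ, Space4) ∞ f)
    (hT : ContMDiff 𝓘(ℝ, Plane) 𝓘(ℝ, Space4) ∞ T) :
    ContMDiff (𝓘(ℝ, ℝ).prod 𝓘(ℝ, Plane)) 𝓘(ℝ, Space4) ∞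
      (fun q : ℝ × M => linearDeformation f T q.1 q.2) :=
  (hf.comp contMDiff_snd).add (contMDiff_fst.smul (hT.comp contMDiff_snd))

/-- A frame of `f` extends to an adapted frame of the deformation `f + tT`, for all `t`, if
`dT = A ∘ df` with a field `A` of skew endomorphisms; it moves infinitesimally by `A`. -/
theorem exists_adaptedFrame (hf : ContMDiff 𝓘(ℝ, Plane) 𝓘(ℝ, Space4) ∞ f)
    (hT : ContMDiff 𝓘(ℝ, Plane) 𝓘(ℝ, Space4) ∞ T) {A : M → End4}
    (hA : ContMDiff 𝓘(ℝ, Plane) 𝓘(ℝ, End4) ∞ A) (hs : ∀ p, IsSkew (A p))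
    (hTA : ∀ p, vdiff T p = (A p).comp (vdiff f p))
    (he : ∀ j, ContMDiff 𝓘(ℝ, Plane) 𝓘(ℝ, Plane).tangent ∞
      (fun q => (⟨q, e j q⟩ : TangentBundle 𝓘(ℝ, Plane) M)))
    (hε : ∀ k, ContMDiff 𝓘(ℝ, Plane) 𝓘(ℝ, Space4) ∞ (eps f e ν k))
    (ho : ∀ p, IsOrthonormalFrameAt o f e ν p) :
    ∃ (e' : ℝ → TangentPair M) (ν' : ℝ → NormalPair M),
      IsAdaptedFrame o univ (linearDeformation f T) e' ν' ∧ e' 0 = e ∧ ν' 0 = ν ∧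
      ∀ k p, HasDerivAt (fun t => eps (linearDeformation f T t) (e' t) (ν' t) k p)
        (A p (eps f e ν k p)) 0 := by
  set ε := eps f e ν with hεdef
  have hon : ∀ p, Orthonormal ℝ fun k => ε k p := fun p => (ho p).1
  set v : ℝ × M → Fin 4 → Space4 := fun q k => ε k q.2 + q.1 • A q.2 (ε k q.2) with hv
  have hvs : ∀ k, ContMDiff (𝓘(ℝ, ℝ).prod 𝓘(ℝ, Plane)) 𝓘(ℝ, Space4) ∞ fun q => v q k := fun k =>
    ((hε k).comp contMDiff_snd).add
      (contMDiff_fst.smul ((hA.clm_apply (hε k)).comp contMDiff_snd))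
  have hli : ∀ q, LinearIndependent ℝ (v q) := fun q =>
    linearIndependent_add_smul (hs q.2) (hon q.2) q.1
  have hv0 : ∀ p, v (0, p) = fun k => ε k p := fun p => by funext k; simp [hv]
  have hvd : ∀ p k, HasDerivAt (fun t => v (t, p) k) (A p (ε k p)) 0 := fun p k => by
    have h : HasDerivAt (fun t : ℝ => ε k p + t • A p (ε k p)) ((1 : ℝ) • A p (ε k p)) 0 :=
      ((hasDerivAt_id (0 : ℝ)).smul_const _).const_add _
    rwa [one_smul] at h
  have hvo : ∀ p, Orthonormal ℝ (v (0, p)) := fun p => by rw [hv0]; exact hon p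
  have hvskew : ∀ p k l, inner ℝ (v (0, p) k) (A p (ε l p)) +
      inner ℝ (A p (ε k p)) (v (0, p) l) = 0 := fun p k l => by
    rw [hv0, hs p, add_neg_cancel]
  have hgs := contMDiff_gramSchmidt hvs hli
  set n : Fin 4 → ℝ × M → ℝ := fun k q => ‖gramSchmidt ℝ (v q) k‖⁻¹ with hn
  have hns : ∀ k, ContMDiff (𝓘(ℝ, ℝ).prod 𝓘(ℝ, Plane)) 𝓘(ℝ, ℝ) ∞ (n k) :=
    contMDiff_norm_gramSchmidt_inv hvs hli
  have hgs0 : ∀ k p, gramSchmidt ℝ (v (0, p)) k = ε k p := fun k p => by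
    rw [(hasDerivAt_gramSchmidt (v := fun t => v (t, p)) (hvd p) (hvo p) (hvskew p) k).1, hv0]
  have hgsd : ∀ k p, HasDerivAt (fun t => gramSchmidt ℝ (v (t, p)) k) (A p (ε k p)) 0 := fun k p =>
    (hasDerivAt_gramSchmidt (v := fun t => v (t, p)) (hvd p) (hvo p) (hvskew p) k).2
  have hn0 : ∀ k p, n k (0, p) = 1 := fun k p => by
    simp only [hn, hgs0, (hon p).1 k, inv_one]
  have hnd : ∀ k p, HasDerivAt (fun t => n k (t, p)) 0 0 := fun k p =>
    hasDerivAt_norm_gramSchmidt_inv (v := fun t => v (t, p)) (hvd p) (hvo p) (hvskew p) k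
  set w : Fin 4 → ℝ × M → Space4 := fun k q => n k q • gramSchmidt ℝ (v q) k with hw
  have hwo : ∀ q, Orthonormal ℝ fun k => w k q := fun q => gramSchmidtNormed_orthonormal (hli q)
  have hws : ∀ k, ContMDiff (𝓘(ℝ, ℝ).prod 𝓘(ℝ, Plane)) 𝓘(ℝ, Space4) ∞ (w k) := fun k =>
    (hns k).smul (hgs k)
  have hw0 : ∀ k p, w k (0, p) = ε k p := fun k p => by
    simp only [hw, hn0, hgs0, one_smul]
  have hwd : ∀ k p, HasDerivAt (fun t => w k (t, p)) (A p (ε k p)) 0 := fun k p => by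
    have := (hnd k p).smul (hgsd k p)
    rw [hn0, one_smul, zero_smul, add_zero] at this
    exact this
  -- The only Gram-Schmidt coefficient acting among the two tangent vectors.
  set c : ℝ × M → ℝ := fun q => inner ℝ (v q 0) (v q 1) / ‖v q 0‖ ^ 2 with hc
  have hcs : ContMDiff (𝓘(ℝ, ℝ).prod 𝓘(ℝ, Plane)) 𝓘(ℝ, ℝ) ∞ c := by
    have h1 : ContMDiff (𝓘(ℝ, ℝ).prod 𝓘(ℝ, Plane)) 𝓘(ℝ, ℝ) ∞ fun q => inner ℝ (v q 0) (v q 1) :=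
      (innerL.contDiff.contMDiff.comp (hvs 0)).clm_apply (hvs 1)
    exact h1.div₀ ((contDiff_norm_sq ℝ).contMDiff.comp (hvs 0)) fun q => by
      have := (hli q).ne_zero 0
      positivity
  have hc0 : ∀ p, c (0, p) = 0 := fun p => by
    have : inner ℝ (v (0, p) 0) (v (0, p) 1) = (0 : ℝ) := (hvo p).2 (by decide)
    simp only [hc, this, zero_div]
  have hcd : ∀ p, HasDerivAt (fun t => c (t, p)) 0 0 := fun p => by
    have h1 := hasDerivAt_inner_of_skew (v := fun t => v (t, p)) (hvd p) (hvskew p) 0 1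
    have h3 : inner ℝ (v (0, p) 0) (v (0, p) 1) = (0 : ℝ) := (hvo p).2 (by decide)
    refine (h1.div (hvd p 0).norm_sq (by rw [(hvo p).1 0]; norm_num)).congr_deriv ?_
    simp [h3]
  have hgs_zero : ∀ q, gramSchmidt ℝ (v q) 0 = v q 0 := fun q => gramSchmidt_bot ℝ (v q)
  have hgs_one : ∀ q, gramSchmidt ℝ (v q) 1 = v q 1 - c q • v q 0 := fun q => by
    rw [gramSchmidt_def, show Finset.Iio (1 : Fin 4) = {0} by decide, Finset.sum_singleton,
      hgs_zero, Submodule.starProjection_singleton]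
    rfl
  set m : Fin 2 → ℝ × M → ℝ := ![fun _ => 0, fun q => -(n 1 q * c q)] with hm
  have hms : ∀ j, ContMDiff (𝓘(ℝ, ℝ).prod 𝓘(ℝ, Plane)) 𝓘(ℝ, ℝ) ∞ (m j) := by
    intro j
    fin_cases j
    · exact contMDiff_const
    · exact ((hns 1).mul hcs).neg
  have hm0 : ∀ j p, m j (0, p) = 0 := by
    intro j p
    fin_cases j
    · rfl
    · simp [hm, hc0]
  have hmd : ∀ j p, HasDerivAt (fun t => m j (t, p)) 0 0 := by
    intro j p
    fin_cases j
    · exact hasDerivAt_const _ _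
    · exact ((hnd 1 p).mul (hcd p)).neg.congr_deriv (by simp)
  -- Since `df_t(e_j) = v_j` and Gram-Schmidt changes the first two vectors only by combinations of
  -- themselves, the same coefficients applied to `e_j` give tangent fields with images `w₁, w₂`.
  -- The remaining two vectors are orthogonal to these, hence normal.
  set e' : ℝ → TangentPair M := fun t j p =>
    n (tIdx j) (t, p) • e j p + m j (t, p) • e 0 p with he'
  set ν' : ℝ → NormalPair M := fun t a p => w (nIdx a) (t, p) with hν'
  have hve : ∀ t j p, vdiff (linearDeformation f T t) p (e j p) = v (t, p) (tIdx j) := by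
    intro t j p
    rw [vdiff_linearDeformation hf hT, hTA]
    change vdiff f p (e j p) + t • A p (vdiff f p (e j p)) = ε (tIdx j) p + t • A p (ε (tIdx j) p)
    rw [hεdef, eps_tIdx]
  have heps : ∀ t k p, eps (linearDeformation f T t) (e' t) (ν' t) k p = w k (t, p) := by
    intro t k p
    refine Fin.addCases (m := 2) (n := 2) (fun j => ?_) (fun a => ?_) k
    · refine (eps_tIdx j p).trans ?_
      have h1 : vdiff (linearDeformation f T t) p (e' t j p) =
          n (tIdx j) (t, p) • vdiff (linearDeformation f T t) p (e j p) +
            m j (t, p) • vdiff (linearDeformation f T t) p (e 0 p) := by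
        refine (map_add (vdiff (linearDeformation f T t) p) _ _).trans ?_
        exact congrArg₂ (· + ·) (map_smul (vdiff (linearDeformation f T t) p) _ _)
          (map_smul (vdiff (linearDeformation f T t) p) _ _)
      rw [h1, hve, hve]
      fin_cases j
      · change n 0 (t, p) • v (t, p) 0 + (0 : ℝ) • v (t, p) 0 =
          n 0 (t, p) • gramSchmidt ℝ (v (t, p)) 0
        rw [hgs_zero, zero_smul, add_zero]
      · change n 1 (t, p) • v (t, p) 1 + -(n 1 (t, p) * c (t, p)) • v (t, p) 0 =
          n 1 (t, p) • gramSchmidt ℝ (v (t, p)) 1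
        rw [hgs_one, smul_sub, smul_smul, neg_smul, sub_eq_add_neg]
    · exact congrFun (eps_nIdx a) p
  have he0 : e' 0 = e := by
    funext j p
    simp only [he', hn0, hm0]
    rw [one_smul, zero_smul, add_zero]
  have hν0 : ν' 0 = ν := by
    funext a p
    simp only [hν', hw0]
    exact congrFun (eps_nIdx a) p
  have hcont : ∀ p : M, Continuous fun t : ℝ => (t, p) := fun p => by fun_prop
  refine ⟨e', ν', ⟨fun j => ?_, fun a => (hws (nIdx a)).contMDiffOn, fun t p _ => ?_,
    fun p _ j => ?_⟩, he0, hν0, fun k p => ?_⟩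
  · have hej : ∀ j, ContMDiff (𝓘(ℝ, ℝ).prod 𝓘(ℝ, Plane)) 𝓘(ℝ, Plane).tangent ∞
        (fun q : ℝ × M => (⟨q.2, e j q.2⟩ : TangentBundle 𝓘(ℝ, Plane) M)) := fun j =>
      (he j).comp contMDiff_snd
    exact (contMDiff_smul_add_smul (X := fun q => e j q.2) (Y := fun q => e 0 q.2) (hej j) (hej 0)
      (hns (tIdx j)) (hms j)).contMDiffOn
  · have hort : Orthonormal ℝ fun k => eps (linearDeformation f T t) (e' t) (ν' t) k p := by
      simp only [heps]
      exact hwo (t, p)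
    refine ⟨hort, ?_, ?_⟩
    -- Positivity is carried from `t = 0`. The pair stays independent because its images under
    -- `df_s` are orthonormal.
    · refine isPositiveBasis_of_path (V := Plane) (v := fun t j => e' t j p) (fun j => ?_)
        (fun s => ?_) ?_ t
      · exact (((hns (tIdx j)).continuous.comp (hcont p)).smul continuous_const).add
          (((hms j).continuous.comp (hcont p)).smul continuous_const)
      · have h1 : LinearIndependent ℝ fun j : Fin 2 => w (tIdx j) (s, p) :=
          (hwo (s, p)).linearIndependent.comp _ (Fin.castAdd_injective 2 2)
        refine Fintype.linearIndependent_iff.2 fun g hg =>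
          Fintype.linearIndependent_iff.1 h1 g ?_
        have h2 := congrArg (vdiff (linearDeformation f T s) p) hg
        rw [map_sum, map_zero] at h2
        rw [← h2]
        refine Finset.sum_congr rfl fun j _ => ?_
        rw [← heps s (tIdx j) p]
        refine Eq.trans ?_ (map_smul (vdiff (linearDeformation f T s) p) (g j) _).symm
        exact congrArg (g j • ·) (eps_tIdx j p)
      · change IsPositiveBasis (o p) fun j => e' 0 j p
        rw [he0]
        exact (ho p).2.1
    · simp only [heps]
      refine isPositiveBasis_of_path (v := fun t k => w k (t, p)) (fun k => ?_)
        (fun s => (hwo (s, p)).linearIndependent) ?_ t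
      · exact (hws k).continuous.comp (hcont p)
      · simp only [hw0]
        exact (ho p).2.2
  · exact hasDerivAt_smul_add_smul (V := Plane) (hnd (tIdx j) p) (hmd j p) (e j p) (e 0 p)
  · simp only [heps]
    exact hwd k p

end Extension

/-! ### Trivial fields are the fields `C f + v` with `C` skew. -/

section Trivial

variable {M : Type*} {f X : M → Space4}

/-- The isometries are `R_t x = exp(tC) x + t v`; the exponential of a skew endomorphism is
orthogonal. -/
theorem isTrivialField_of_skew {C : End4} (hC : IsSkew C) {v : Space4}
    (h : ∀ p, X p = C (f p) + v) : IsTrivialField f X := by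
  have hsk : ∀ t : ℝ, t • C ∈ skewAdjoint End4 := by
    intro t
    rw [skewAdjoint.mem_iff, star_smul, star_trivial, ← smul_neg]
    congr 1
    rw [ContinuousLinearMap.star_eq_adjoint]
    refine ((ContinuousLinearMap.eq_adjoint_iff _ _).2 fun x y => ?_).symm
    rw [neg_apply, inner_neg_left, hC x y, neg_neg]
  let : NormedAlgebra ℚ End4 := NormedAlgebra.restrictScalars ℚ ℝ End4
  set U : ℝ → unitary End4 := fun t =>
    ⟨NormedSpace.exp (t • C), NormedSpace.exp_mem_unitary_of_mem_skewAdjoint (hsk t)⟩ with hU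
  set R : ℝ → (Space4 ≃ᵢ Space4) := fun t =>
    (Unitary.linearIsometryEquiv (U t)).toIsometryEquiv.trans (IsometryEquiv.addRight (t • v))
    with hR
  have hRa : ∀ t x, R t x = NormedSpace.exp (t • C) x + t • v := fun t x => rfl
  have hexp : ContDiff ℝ ∞ (NormedSpace.exp : End4 → End4) :=
    contDiff_iff_contDiffAt.2 fun x => (NormedSpace.exp_analytic (𝕂 := ℝ) x).contDiffAt
  refine ⟨R, ?_, ?_, fun p => ?_⟩
  · simp only [hRa]
    exact ((hexp.comp (contDiff_fst.smul contDiff_const)).clm_apply contDiff_snd).add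
      (contDiff_fst.smul contDiff_const)
  · ext1 x
    rw [hRa]
    simp only [zero_smul, NormedSpace.exp_zero, add_zero]
    rfl
  · simp only [hRa]
    have h1 : HasDerivAt (fun t : ℝ => NormedSpace.exp (t • C)) C 0 := by
      have := hasDerivAt_exp_smul_const (𝕂 := ℝ) C (0 : ℝ)
      simpa using this
    have h2 := h1.clm_apply (hasDerivAt_const (0 : ℝ) (f p))
    have h3 := h2.add ((hasDerivAt_id (0 : ℝ)).smul_const v)
    rw [h p]
    exact h3.congr_deriv (by simp)

/-- Isometries of ℝ⁴ are affine, by Mazur-Ulam. The derivative at `t = 0` of their linear parts is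
linear by uniqueness of derivatives, and skew because the linear parts preserve inner products. -/
theorem exists_skew_of_isTrivialField (h : IsTrivialField f X) :
    ∃ (C : End4) (v : Space4), IsSkew C ∧ ∀ p, X p = C (f p) + v := by
  obtain ⟨R, hR, hR0, hX⟩ := h
  have hRd : ∀ x, HasDerivAt (fun t => R t x) (deriv (fun t => R t x) 0) 0 := by
    intro x
    have h1 : ContDiff ℝ ∞ fun t : ℝ => R t x := hR.comp (contDiff_id.prodMk contDiff_const)
    exact (h1.differentiable (by simp) 0).hasDerivAt
  set W : Space4 → Space4 := fun x => deriv (fun t => R t x) 0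
  set L : ℝ → (Space4 ≃ₗᵢ[ℝ] Space4) := fun t =>
    (R t).toRealAffineIsometryEquiv.linearIsometryEquiv
  have hL : ∀ t x, L t x = R t x - R t 0 := by
    intro t x
    have := (R t).toRealAffineIsometryEquiv.map_vadd 0 x
    simp only [vadd_eq_add, add_zero, IsometryEquiv.coeFn_toRealAffineIsometryEquiv] at this
    rw [this, add_sub_cancel_right]
  have hLd : ∀ x, HasDerivAt (fun t => L t x) (W x - W 0) 0 := fun x => by
    simp only [hL]
    exact (hRd x).sub (hRd 0)
  have hL0 : ∀ x, L 0 x = x := fun x => by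
    rw [hL, hR0]
    exact sub_zero x
  set C : Space4 →ₗ[ℝ] Space4 :=
    { toFun := fun x => W x - W 0
      map_add' := fun x y => by
        refine (hLd (x + y)).unique ?_
        simp only [map_add]
        exact (hLd x).add (hLd y)
      map_smul' := fun a x => by
        refine (hLd (a • x)).unique ?_
        simp only [map_smul]
        exact (hLd x).const_smul a }
  refine ⟨LinearMap.toContinuousLinearMap C, W 0, fun x y => ?_, fun p => ?_⟩
  · have h1 := (hLd x).inner ℝ (hLd y)
    simp only [LinearIsometryEquiv.inner_map_map, hL0] at h1
    have h2 := h1.unique (hasDerivAt_const _ _)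
    change inner ℝ (W x - W 0) y = -inner ℝ x (W y - W 0)
    linarith
  · change X p = (W (f p) - W 0) + W 0
    rw [sub_add_cancel]
    exact (hX p).unique (hRd (f p))

end Trivial

/-! ### Pairs `(A, T)` with `dT = A ∘ df` and realized solutions. -/

section Realization

variable {M : Type*} [TopologicalSpace M] [ChartedSpace Plane M]

section Vdiff

variable {V : Type*} [NormedAddCommGroup V] [NormedSpace ℝ V] {g h : M → V}

theorem vdiff_add (hg : ContMDiff 𝓘(ℝ, Plane) 𝓘(ℝ, V) ∞ g)
    (hh : ContMDiff 𝓘(ℝ, Plane) 𝓘(ℝ, V) ∞ h) (p : M) :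
    vdiff (fun q => g q + h q) p = vdiff g p + vdiff h p :=
  ((hg.mdifferentiable (by simp) p).hasMFDerivAt.add
    (hh.mdifferentiable (by simp) p).hasMFDerivAt).mfderiv

theorem vdiff_sub (hg : ContMDiff 𝓘(ℝ, Plane) 𝓘(ℝ, V) ∞ g)
    (hh : ContMDiff 𝓘(ℝ, Plane) 𝓘(ℝ, V) ∞ h) (p : M) :
    vdiff (fun q => g q - h q) p = vdiff g p - vdiff h p :=
  ((hg.mdifferentiable (by simp) p).hasMFDerivAt.sub
    (hh.mdifferentiable (by simp) p).hasMFDerivAt).mfderiv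

theorem vdiff_const (c : V) (p : M) : vdiff (fun _ => c) p = 0 :=
  mfderiv_const

end Vdiff

variable [IsManifold 𝓘(ℝ, Plane) ∞ M]
variable {o : ∀ p : M, Orientation ℝ (TangentSpace 𝓘(ℝ, Plane) p) (Fin 2)}
  {f T : M → Space4} {e : TangentPair M} {ν : NormalPair M} {A : M → End4}
  {φ : Fin 4 → Fin 4 → OneForm M}

theorem ExtendsOver.mono {D D' : Set (ℝ × M)} (h : ExtendsOver o D f T e ν φ) (hD : D' ⊆ D) :
    ExtendsOver o D' f T e ν φ := by
  obtain ⟨e', ν', ⟨h1, h2, h3, h4⟩, h5⟩ := h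
  exact ⟨e', ν', ⟨fun j => (h1 j).mono hD, fun a => (h2 a).mono hD,
    fun t p hp => h3 t p (hD hp), fun p hp => h4 p (hD hp)⟩, fun p hp => h5 p (hD hp)⟩

theorem contMDiff_eps (hf : ContMDiff 𝓘(ℝ, Plane) 𝓘(ℝ, Space4) ∞ f)
    (he : ∀ j, ContMDiff 𝓘(ℝ, Plane) 𝓘(ℝ, Plane).tangent ∞
      (fun q => (⟨q, e j q⟩ : TangentBundle 𝓘(ℝ, Plane) M)))
    (hν : ∀ a, ContMDiff 𝓘(ℝ, Plane) 𝓘(ℝ, Space4) ∞ (ν a)) (k : Fin 4) :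
    ContMDiff 𝓘(ℝ, Plane) 𝓘(ℝ, Space4) ∞ (eps f e ν k) :=
  contMDiff_slice (D := univ) (G := fun _ => eps f e ν k) (fun _ => mem_univ _)
    (contMDiffOn_eps (F := fun _ => f) (e := fun _ => e) (ν := fun _ => ν) isOpen_univ
      (hf.comp contMDiff_snd).contMDiffOn (fun j => ((he j).comp contMDiff_snd).contMDiffOn)
      (fun a => ((hν a).comp contMDiff_snd).contMDiffOn) k)

theorem extendsOver_univ (hf : ContMDiff 𝓘(ℝ, Plane) 𝓘(ℝ, Space4) ∞ f)
    (hT : ContMDiff 𝓘(ℝ, Plane) 𝓘(ℝ, Space4) ∞ T)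
    (hA : ContMDiff 𝓘(ℝ, Plane) 𝓘(ℝ, End4) ∞ A) (hs : ∀ p, IsSkew (A p))
    (hTA : ∀ p, vdiff T p = (A p).comp (vdiff f p))
    (he : ∀ j, ContMDiff 𝓘(ℝ, Plane) 𝓘(ℝ, Plane).tangent ∞
      (fun q => (⟨q, e j q⟩ : TangentBundle 𝓘(ℝ, Plane) M)))
    (hν : ∀ a, ContMDiff 𝓘(ℝ, Plane) 𝓘(ℝ, Space4) ∞ (ν a))
    (ho : ∀ p, IsOrthonormalFrameAt o f e ν p) :
    ExtendsOver o univ f T e ν (frameForm (eps f e ν) (vdiff A)) := by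
  obtain ⟨e', ν', had, he0, hν0, hmove⟩ :=
    exists_adaptedFrame hf hT hA hs hTA he (contMDiff_eps hf he hν) ho
  obtain ⟨A', -, -, -, hmove', hco, hconn⟩ := exists_rotation isOpen_univ (fun _ => mem_univ _)
    (contMDiff_linearDeformation hf hT).contMDiffOn had
  rw [he0, hν0, linearDeformation_zero] at hmove' hconn
  -- The rotation field extracted from the constructed frame has the same frame velocities as the
  -- prescribed one.
  have hAA : A' = A := by
    funext p
    refine End4.ext_frame (ho p).1 fun k l => ?_
    rw [(hmove' k p).unique (hmove k p)]
  rw [hAA] at hconn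
  exact ⟨e', ν', had, fun p _ => ⟨fun j => by rw [he0], fun a => by rw [hν0],
    fun j => hco j p, fun k l => hconn k l p⟩⟩

theorem exists_rotation_of_realizes (hf : ContMDiff 𝓘(ℝ, Plane) 𝓘(ℝ, Space4) ∞ f)
    (hT : ContMDiff 𝓘(ℝ, Plane) 𝓘(ℝ, Space4) ∞ T) (h : Realizes o f T e ν φ) :
    ∃ A : M → End4, ContMDiff 𝓘(ℝ, Plane) 𝓘(ℝ, End4) ∞ A ∧ (∀ p, IsSkew (A p)) ∧
      (∀ p, vdiff T p = (A p).comp (vdiff f p)) ∧ frameForm (eps f e ν) (vdiff A) = φ := by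
  obtain ⟨D, hD, hD₀, e', ν', had, hD'⟩ := h
  have he0 : e' 0 = e := by
    funext j p
    exact (hD' p (hD₀ p)).1 j
  have hν0 : ν' 0 = ν := by
    funext a p
    exact (hD' p (hD₀ p)).2.1 a
  obtain ⟨A, hA, hs, hTA, -, -, hconn⟩ := exists_rotation hD hD₀
    (contMDiff_linearDeformation hf hT).contMDiffOn had
  rw [he0, hν0, linearDeformation_zero] at hconn
  rw [variation_linearDeformation, linearDeformation_zero] at hTA
  refine ⟨A, hA, hs, hTA, ?_⟩
  funext k l p
  refine ContinuousLinearMap.ext fun X => ?_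
  exact (hconn k l p X).unique ((hD' p (hD₀ p)).2.2.2 k l X)

/-- Two successive integrations: closedness of the assembled form gives `A`, and its symmetry
against `df` gives `T`. -/
theorem exists_rotation_of_isFundamentalSolution [SimplyConnectedSpace M]
    (hf : ContMDiff 𝓘(ℝ, Plane) 𝓘(ℝ, Space4) ∞ f)
    (hε : ∀ k, ContMDiff 𝓘(ℝ, Plane) 𝓘(ℝ, Space4) ∞ (eps f e ν k))
    (ho : ∀ p, IsOrthonormalFrameAt o f e ν p) (hφ : IsFundamentalSolution f e ν φ) :
    ∃ (A : M → End4) (T : M → Space4), ContMDiff 𝓘(ℝ, Plane) 𝓘(ℝ, End4) ∞ A ∧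
      ContMDiff 𝓘(ℝ, Plane) 𝓘(ℝ, Space4) ∞ T ∧ (∀ p, IsSkew (A p)) ∧
      (∀ p, vdiff T p = (A p).comp (vdiff f p)) ∧ frameForm (eps f e ν) (vdiff A) = φ := by
  obtain ⟨hd, hskew, hsymm⟩ := frameCombination_spec hε ho hφ
  obtain ⟨A₁, hA₁, hA₁d⟩ := exists_vdiff_eq_of_closed (frameCombination_isSmooth hε hφ.smooth) hd
  obtain ⟨p₀⟩ : Nonempty M := inferInstance
  -- A primitive is skew only up to a constant. Normalized to vanish at `p₀` it is skew everywhere,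
  -- since its differential is skew and skewness is a linear condition.
  set A : M → End4 := fun p => A₁ p - A₁ p₀ with hA
  have hAs : ContMDiff 𝓘(ℝ, Plane) 𝓘(ℝ, End4) ∞ A := hA₁.sub contMDiff_const
  have hAd : ∀ p, vdiff A p = frameCombination (eps f e ν) φ p := fun p => by
    rw [hA, vdiff_sub hA₁ contMDiff_const, vdiff_const, sub_zero, hA₁d]
  have hAskew : ∀ p, IsSkew (A p) := by
    intro p x y
    set L : End4 →L[ℝ] ℝ := evalL y x + evalL x y with hL
    have h1 := eq_of_vdiff_eq_zero (h := fun q => L (A q))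
      (L.contDiff.contMDiff.comp hAs) (fun q => by
        ext1 u
        rw [vdiff_clm L hAs, hAd, hL, add_apply, evalL_apply, evalL_apply, real_inner_comm,
          hskew q u, neg_add_cancel]
        rfl) p p₀
    have h2 : L (A p₀) = 0 := by
      have h0 : A p₀ = 0 := sub_self (A₁ p₀)
      rw [h0, map_zero]
    rw [h2, hL, add_apply, evalL_apply, evalL_apply, real_inner_comm] at h1
    linarith
  have hsm : VForm.IsSmooth (fun p => (A p).comp (vdiff f p)) := (vdiff_isSmooth hf).clm_comp hAs
  -- `d(A ∘ df) = dA ∧ df`, which vanishes by the symmetry of the form.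
  obtain ⟨T, hT, hTd⟩ := exists_vdiff_eq_of_closed hsm fun p u v => by
    rw [VForm.d_clm_comp (vdiff_isSmooth hf) hAs, VForm.d_vdiff hf, map_zero, zero_add, hAd,
      hsymm, sub_self]
  refine ⟨A, T, hAs, hT, hAskew, hTd, ?_⟩
  rw [show vdiff A = frameCombination (eps f e ν) φ from funext hAd]
  funext k l
  exact frameForm_frameCombination (fun p => (ho p).1) φ k l

omit [IsManifold 𝓘(ℝ, Plane) ∞ M] in
theorem vdiff_eq_of_frameForm_eq (ho : ∀ p, IsOrthonormalFrameAt o f e ν p) {α β : VForm M End4}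
    (h : frameForm (eps f e ν) α = frameForm (eps f e ν) β) (p : M) : α p = β p := by
  ext1 u
  refine End4.ext_frame (ho p).1 fun k l => ?_
  exact congrArg (fun γ : Fin 4 → Fin 4 → OneForm M => γ k l p u) h

end Realization

end InfBending

end

/-! ### The theorem. -/

open InfBending in
theorem mainTheorem12 {M : Type*} [TopologicalSpace M] [T2Space M] [SecondCountableTopology M]
    [ChartedSpace InfBending.Plane M] [IsManifold 𝓘(ℝ, InfBending.Plane) ∞ M]
    [SimplyConnectedSpace M]
    (o : ∀ p : M, Orientation ℝ (TangentSpace 𝓘(ℝ, InfBending.Plane) p) (Fin 2))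
    (ho : InfBending.IsSurfaceOrientation o)
    (f : M → InfBending.Space4)
    (hf : ContMDiff 𝓘(ℝ, InfBending.Plane) 𝓘(ℝ, InfBending.Space4) ∞ f)
    (hf' : ∀ p, Function.Injective (InfBending.diff f p)) :
    -- variations of the connection forms solve the fundamental system
    (∀ (D : Set (ℝ × M)) (F : ℝ → M → InfBending.Space4)
        (e : ℝ → InfBending.TangentPair M) (ν : ℝ → InfBending.NormalPair M),
      IsOpen D → (∀ p, (0, p) ∈ D) →
      InfBending.IsInfIsometricDeformation D f F →
      InfBending.IsAdaptedFrame o D F e ν →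
      (∀ j p, InfBending.HasVariationAt (fun t => InfBending.coframe (F t) (e t) j) 0 p) ∧
      ∃ φ : Fin 4 → Fin 4 → InfBending.OneForm M,
        (∀ k l p,
          InfBending.HasVariationAt (fun t => InfBending.connForm (F t) (e t) (ν t) k l)
            (φ k l) p) ∧
        InfBending.IsFundamentalSolution f (e 0) (ν 0) φ) ∧
    -- every solution is realized by a bending field, unique up to trivial ones
    (∀ (e : InfBending.TangentPair M) (ν : InfBending.NormalPair M),
      (∀ j, ContMDiff 𝓘(ℝ, InfBending.Plane) 𝓘(ℝ, InfBending.Plane).tangent ∞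
        (fun q => (⟨q, e j q⟩ : TangentBundle 𝓘(ℝ, InfBending.Plane) M))) →
      (∀ a, ContMDiff 𝓘(ℝ, InfBending.Plane) 𝓘(ℝ, InfBending.Space4) ∞ (ν a)) →
      (∀ p, InfBending.IsOrthonormalFrameAt o f e ν p) →
      ∀ φ : Fin 4 → Fin 4 → InfBending.OneForm M,
        InfBending.IsFundamentalSolution f e ν φ →
        ∃ T : M → InfBending.Space4,
          InfBending.IsBendingField f T ∧
          InfBending.Realizes o f T e ν φ ∧
          (∀ p, ∃ (δ : ℝ) (U : Set M), 0 < δ ∧ IsOpen U ∧ p ∈ U ∧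
            InfBending.ExtendsOver o (Ioo (-δ) δ ×ˢ U) f T e ν φ) ∧
          ∀ T' : M → InfBending.Space4, InfBending.IsBendingField f T' →
            (InfBending.Realizes o f T' e ν φ ↔
              InfBending.IsTrivialField f (fun p => T' p - T p))) := by
  refine ⟨fun D F e ν hD hD₀ hF had => ?_, fun e ν he hν hon φ hφ => ?_⟩
  · obtain ⟨A, hA, hs, hTA, -, hco, hconn⟩ := exists_rotation hD hD₀ hF.1 had
    have hF0 : F 0 = f := hF.2.1
    rw [hF0] at hTA hconn
    have hε : ∀ k, ContMDiff 𝓘(ℝ, Plane) 𝓘(ℝ, Space4) ∞ (eps f (e 0) (ν 0) k) := fun k =>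
      hF0 ▸ contMDiff_slice (G := fun t => eps (F t) (e t) (ν t) k) hD₀
        (contMDiffOn_eps hD hF.1 had.1 had.2.1 k)
    exact ⟨hco, _, hconn, isFundamentalSolution_frameForm hf hε
      (fun p => hF0 ▸ had.2.2.1 0 p (hD₀ p)) hA hs (contMDiff_variation hD hD₀ hF.1) hTA⟩
  · obtain ⟨A, T, hA, hT, hs, hTA, rfl⟩ :=
      exists_rotation_of_isFundamentalSolution hf (contMDiff_eps hf he hν) hon hφ
    have hext := extendsOver_univ hf hT hA hs hTA he hν hon
    refine ⟨T, ⟨hT, fun p (X : Plane) (Y : Plane) => ?_⟩,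
      ⟨univ, isOpen_univ, fun _ => mem_univ _, hext⟩,
      -- Any interval and neighbourhood would do, the extension being defined on all of ℝ × M.
      fun p => ⟨1, univ, one_pos, isOpen_univ, mem_univ p, hext.mono (subset_univ _)⟩,
      fun T' hT' => ⟨fun h => ?_, fun h => ?_⟩⟩
    · change inner ℝ (vdiff T p X) (vdiff f p Y) + inner ℝ (vdiff f p X) (vdiff T p Y) = 0
      rw [hTA, ContinuousLinearMap.comp_apply, ContinuousLinearMap.comp_apply, hs p,
        neg_add_cancel]
    · obtain ⟨A', hA', hs', hTA', hAA'⟩ := exists_rotation_of_realizes hf hT'.1 h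
      obtain ⟨p₀⟩ : Nonempty M := inferInstance
      -- Both rotation fields have the components `φ`, so `dA' = dA` and the difference is constant
      -- on the connected surface.
      have hC : ∀ p, A' p - A p = A' p₀ - A p₀ := fun p =>
        eq_of_vdiff_eq_zero (h := fun q => A' q - A q) (hA'.sub hA) (fun q => by
          rw [vdiff_sub hA' hA, vdiff_eq_of_frameForm_eq hon hAA' q, sub_self]) p p₀
      set C : End4 := A' p₀ - A p₀ with hCdef
      have hCf : ContMDiff 𝓘(ℝ, Plane) 𝓘(ℝ, Space4) ∞ fun p => C (f p) :=
        C.contDiff.contMDiff.comp hf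
      -- `d(T' - T) = (A' - A) ∘ df = d(C f)`, so only a translation remains.
      have hv : ∀ p, (T' p - T p) - C (f p) = (T' p₀ - T p₀) - C (f p₀) := fun p =>
        eq_of_vdiff_eq_zero (h := fun q => (T' q - T q) - C (f q)) ((hT'.1.sub hT).sub hCf)
          (fun q => by
            ext1 u
            rw [vdiff_sub (hT'.1.sub hT) hCf, vdiff_sub hT'.1 hT, hTA, hTA', sub_apply,
              vdiff_clm C hf, ← hC q]
            exact sub_self _) p p₀
      refine isTrivialField_of_skew (C := C) (v := (T' p₀ - T p₀) - C (f p₀)) (fun x y => ?_)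
        fun p => by rw [← hv p, add_sub_cancel]
      rw [hCdef, sub_apply, sub_apply, inner_sub_left, inner_sub_right, hs', hs]
      ring
    · obtain ⟨C, v, hC, hTC⟩ := exists_skew_of_isTrivialField h
      -- `A + C` is the rotation field of `T'`; a constant summand does not change `dA`, hence not
      -- the variations.
      have hCs : ∀ p, IsSkew (A p + C) := fun p x y => by
        rw [add_apply, add_apply, inner_add_left, inner_add_right, hs, hC]
        ring
      have hTA' : ∀ p, vdiff T' p = (A p + C).comp (vdiff f p) := by
        intro p
        have h1 : T' = fun q => T q + (C (f q) + v) := by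
          funext q
          rw [← hTC q, add_sub_cancel]
        have hCf : ContMDiff 𝓘(ℝ, Plane) 𝓘(ℝ, Space4) ∞ fun p => C (f p) :=
          C.contDiff.contMDiff.comp hf
        have hCv : ContMDiff 𝓘(ℝ, Plane) 𝓘(ℝ, Space4) ∞ fun p => C (f p) + v :=
          hCf.add contMDiff_const
        ext1 u
        rw [h1, vdiff_add hT hCv, vdiff_add hCf contMDiff_const, vdiff_const,
          add_zero, hTA, add_apply, vdiff_clm C hf]
        rfl
      have hext' := extendsOver_univ hf hT'.1 (hA.add contMDiff_const) hCs hTA' he hν hon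
      have h2 : vdiff (fun p => A p + C) = vdiff A := funext fun p => by
        rw [vdiff_add hA contMDiff_const, vdiff_const, add_zero]
      refine ⟨univ, isOpen_univ, fun _ => mem_univ _, ?_⟩
      rw [← h2]
      exact hext'
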